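/- Let $k$ and $q$ be positive integers such that $p^3\mid q$ for every prime $p$ dividing $q$. For a positive integer $\ell$, let $\mathcal A(\ell)$ be the space of holomorphic cusp forms of weight $k$ on $\Gamma_0(\ell)$, with the Petersson inner product $$\langle f,g\rangle=\frac{V}{\operatorname{vol}(\Gamma_0(\ell)\backslash\mathbb H)}\int_{\Gamma_0(\ell)\backslash\mathbb H} \overline{f(z)}\,g(z)\,y^k\,\frac{dx\,dy}{y^2},\qquad z=x+iy,$$ where $\operatorname{vol}$ is taken with respect to $dx\,dy/y^2$ and $V>0$ is a constant independent of $\ell$. Let $\mathcal A^*(q)$ be the newspace, i.e. the orthogonal complement in $\mathcal A(q)$ of the span of the forms $z\mapsto d^{k/2}\varphi(dz)$ with $\varphi\in\mathcal A(\ell)$, where $\ell\ne q$ runs over the divisors of $q$ and $d$ over the divisors of $q/\ell$. Let $\mathcal B^*(q)$ be any orthonormal basis of $\mathcal A^*(q)$ and, for each $\ell\mid q$, let $\mathcal B(\ell)$ be any orthonormal basis of $\mathcal A(\ell)$. Write $\varphi(z)=\sum_{n\ge1}n^{k/2}\rho(n;\varphi)e^{2\pi i n z}$ for the Fourier expansion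 of a cusp form $\varphi$ and, for positive integers $m,n$, put $$\Delta^*(m,n;q)=\sum_{\varphi\in\mathcal B^*(q)}\rho(m;\varphi)\overline{\rho(n;\varphi)},\qquad \Delta(m,n;\ell)=\sum_{\varphi\in\mathcal B(\ell)}\rho(m;\varphi)\overline{\rho(n;\varphi)}.$$ Then for all positive integers $m,n$, $$\Delta^*(m,n;q)=\sum_{\substack{d\mid\gcd(m,n,q)\\ e\mid q}}\mu(d)\mu(e)\,\Delta\Big(\frac md,\frac nd;\frac q{de}\Big),$$ where $\mu$ is the Möbius function and terms with $\mu(d)\mu(e)=0$ are read as $0$ (in all other terms $de\mid q$). -/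

import Mathlib

open UpperHalfPlane CongruenceSubgroup
open scoped MatrixGroups ComplexConjugate

noncomputable section

namespace NewformAverage

/-- The space `𝒜(ℓ)` of holomorphic cusp forms of weight `k` on `Γ₀(ℓ)`. -/
abbrev CuspSpace (k ℓ : ℕ) : Type :=
  CuspForm (Gamma0 ℓ : Subgroup (GL (Fin 2) ℝ)) (k : ℤ)

/-- The integral of a `Γ₀(ℓ)`-invariant function `F` over `Γ₀(ℓ) \ ℍ` with respect to the
hyperbolic measure `dx dy / y²` (Mathlib's `volume` on `ℍ`). If `g` runs over representatives of
`SL₂(ℤ) / Γ₀(ℓ)`, then `g⁻¹` runs over representatives of `Γ₀(ℓ) \ SL₂(ℤ)`, and the translates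
`g⁻¹ 𝒟` of the standard fundamental domain of `SL₂(ℤ)` tile a fundamental domain of `Γ₀(ℓ)`
(note that `-1 ∈ Γ₀(ℓ)`). -/
def quotientIntegral (ℓ : ℕ) (F : ℍ → ℂ) : ℂ :=
  ∑ᶠ c : SL(2, ℤ) ⧸ Gamma0 ℓ, ∫ z in ModularGroup.fd, F (c.out⁻¹ • z)

/-- The Petersson inner product on `𝒜(ℓ)` for the hyperbolic measure on `Γ₀(ℓ) \ ℍ` rescaled to
have total volume `V`:
`⟨f, g⟩ = V / vol(Γ₀(ℓ) \ ℍ) * ∫_{Γ₀(ℓ) \ ℍ} conj (f z) * g z * y ^ k dx dy / y²`. -/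
def inner (V : ℝ) {k ℓ : ℕ} (f g : CuspSpace k ℓ) : ℂ :=
  (V : ℂ) / quotientIntegral ℓ (fun _ => 1) * quotientIntegral ℓ (petersson k f g)

/-- The function `φ|_d (z) = d ^ (k / 2) * φ (d z)` on `ℍ`, for `d ≥ 1`. -/
def dilate {k ℓ : ℕ} (d : ℕ) (φ : CuspSpace k ℓ) (z : ℍ) : ℂ :=
  (((d : ℝ) ^ ((k : ℝ) / 2) : ℝ) : ℂ) * φ (ofComplex ((d : ℂ) * (z : ℂ)))

/-- The oldspace of `𝒜(q)`: the span of the forms `φ|_d` for `φ ∈ 𝒜(ℓ)`, where `ℓ` runs over the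
divisors `ℓ ≠ q` of `q` and `d` over the divisors of `q / ℓ`. -/
def oldspace (k q : ℕ) : Submodule ℂ (CuspSpace k q) :=
  Submodule.span ℂ {ψ | ∃ ℓ d : ℕ, ℓ ∣ q ∧ ℓ ≠ q ∧ d ∣ q / ℓ ∧
    ∃ φ : CuspSpace k ℓ, (ψ : ℍ → ℂ) = dilate d φ}

/-- The newspace `𝒜*(q)`: the orthogonal complement of the oldspace in `𝒜(q)`. -/
def newspace (V : ℝ) (k q : ℕ) : Set (CuspSpace k q) :=
  {f | ∀ g ∈ oldspace k q, inner V g f = 0}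

/-- `B` is an orthonormal basis of the subspace `S` of `𝒜(ℓ)`. -/
structure IsOrthonormalBasis (V : ℝ) {k ℓ : ℕ} (S : Set (CuspSpace k ℓ))
    (B : Finset (CuspSpace k ℓ)) : Prop where
  subset : (B : Set (CuspSpace k ℓ)) ⊆ S
  norm_eq_one : ∀ f ∈ B, inner V f f = 1
  orthogonal : ∀ f ∈ B, ∀ g ∈ B, f ≠ g → inner V f g = 0
  spanning : S ⊆ Submodule.span ℂ (B : Set (CuspSpace k ℓ))

/-- The normalized Fourier coefficient `ρ(n; φ)`, `n ≥ 1`, where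
`φ(z) = ∑_{n ≥ 1} n ^ (k / 2) * ρ(n; φ) * exp (2 π i n z)`. -/
def rho {k ℓ : ℕ} (n : ℕ) (φ : CuspSpace k ℓ) : ℂ :=
  (qExpansion 1 φ).coeff n / (((n : ℝ) ^ ((k : ℝ) / 2) : ℝ) : ℂ)

/-- The sum of `ρ(m; φ) * conj (ρ(n; φ))` over `φ ∈ B`. -/
def coeffSum {k ℓ : ℕ} (B : Finset (CuspSpace k ℓ)) (m n : ℕ) : ℂ :=
  ∑ φ ∈ B, rho m φ * conj (rho n φ)

end NewformAverage

end

/-!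
Let `q = d e M` with `d, e ∣ M`. Averaging a form `f` of level `q` over the translates by
`[1, i / d; 0, 1]` (`i` mod `d`) and by `[1, 0; q j / e, 1]` (`j` mod `e`) amounts, after
conjugation by `[d, 0; 0, 1]`, to taking a trace down to level `M`, so the result is `ψ|_d` with
`ψ ∈ 𝒜(M)`. The cube condition makes this available for all squarefree `d, e ∣ q`, and the signed
sum of these averages over `d` and `e` with weights `μ(d) μ(e)` is the projection to the newspace:
the terms other than `d = e = 1` are oldforms, and each generator of the oldspace is fixed, for some
prime `p ∣ q`, by `[1, 1 / p; 0, 1]` or by `[1, 0; q / p, 1]`, so that in its inner product with the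
sum the terms for `d` and `p d` (or for `e` and `p e`) cancel. The formula is the `m`-th coefficient
of the projection of the form `R` representing the functional `conj (ρ(n; ·))`.
-/

noncomputable section

namespace NewformAverage

open MeasureTheory
open scoped ENNReal Pointwise ModularForm

section Tilings

variable {G X : Type*} [Group G]

lemma tsum_eq_tsum_cosets (H : Subgroup G) (f : G → ℝ≥0∞) :
    ∑' g, f g = ∑' c : G ⧸ H, ∑' h : H, f (c.out * h) := by
  have hb : Function.Bijective (fun p : (G ⧸ H) × H => p.1.out * (p.2 : G)) := by
    refine ⟨fun ⟨c, h⟩ ⟨c', h'⟩ e => ?_, fun g => ?_⟩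
    · obtain rfl : c = c' := by
        simpa [QuotientGroup.mk_mul_of_mem] using congrArg (QuotientGroup.mk (s := H)) e
      simpa using e
    · exact ⟨(g, ⟨(QuotientGroup.mk (s := H) g).out⁻¹ * g, QuotientGroup.eq.mp (by simp)⟩), by simp⟩
  rw [← (Equiv.ofBijective _ hb).tsum_eq, ENNReal.tsum_prod']
  rfl

variable [MulAction G X] [MeasurableSpace X] [MeasurableConstSMul G X]

/-- A density `w` on `X` whose translates under `H` add up to the constant `C` almost everywhere:
the analogue of (`C` times) a fundamental domain that is meaningful for non-faithful actions and
for densities that are not indicator functions. -/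
structure IsTiling (μ : Measure X) (H : Subgroup G) (w : X → ℝ≥0∞) (C : ℝ≥0∞) : Prop where
  measurable : Measurable w
  tsum_eq : ∀ᵐ x ∂μ, ∑' h : H, w (h • x) = C

namespace IsTiling

variable {μ : Measure X} [SMulInvariantMeasure G X μ] {H K : Subgroup G} {w w' : X → ℝ≥0∞}
  {C C' : ℝ≥0∞}

lemma conjAct_smul (hw : IsTiling μ H w C) (g : G) :
    IsTiling μ (ConjAct.toConjAct g • H) (fun x => w (g⁻¹ • x)) C where
  measurable := hw.measurable.comp (measurable_const_smul _)
  tsum_eq := by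
    have h := (measurePreserving_smul g⁻¹ μ).quasiMeasurePreserving.ae hw.tsum_eq
    filter_upwards [h] with x hx
    rw [← hx, ← (Subgroup.equivSMul (ConjAct.toConjAct g) H).toEquiv.tsum_eq]
    refine tsum_congr fun h => congrArg w ?_
    change g⁻¹ • ((ConjAct.toConjAct g • (h : G)) • x) = (h : G) • g⁻¹ • x
    rw [ConjAct.toConjAct_smul, smul_smul, smul_smul]
    group

lemma of_le [Countable K] (hHK : H ≤ K) (hw : IsTiling μ H w C) :
    IsTiling μ K w (∑' _ : K ⧸ H.subgroupOf K, C) where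
  measurable := hw.measurable
  tsum_eq := by
    have : Countable (K ⧸ H.subgroupOf K) := inferInstanceAs (Countable (Quotient _))
    have hQ : ∀ᵐ x ∂μ, ∀ c : K ⧸ H.subgroupOf K, ∑' h : H, w (h • ((c.out : G)⁻¹ • x)) = C :=
      ae_all_iff.mpr fun c =>
        (measurePreserving_smul (c.out : G)⁻¹ μ).quasiMeasurePreserving.ae hw.tsum_eq
    filter_upwards [hQ] with x hx
    rw [← (Equiv.inv K).tsum_eq, tsum_eq_tsum_cosets (H.subgroupOf K)]
    refine tsum_congr fun c => ?_
    rw [← hx c, ← ((Subgroup.subgroupOfEquivOfLe hHK).toEquiv.trans (Equiv.inv H)).tsum_eq]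
    refine tsum_congr fun h => congrArg w ?_
    change ((c.out * h : K)⁻¹ : G) • x = ((h : K) : G)⁻¹ • (c.out : G)⁻¹ • x
    rw [smul_smul, Subgroup.coe_mul, mul_inv_rev]

variable [Countable H] {A : Set X}

omit [SMulInvariantMeasure G X μ] in
lemma mul_setLIntegral (hw : IsTiling μ H w C) (hw' : Measurable w') :
    C * ∫⁻ x in A, w' x ∂μ = ∑' h : H, ∫⁻ x in A, w' x * w (h • x) ∂μ := by
  rw [← lintegral_tsum (f := fun (h : H) x => w' x * w (h • x)) fun h => (hw'.mul
    (hw.measurable.comp (measurable_const_smul (h : G)))).aemeasurable, ← lintegral_const_mul _ hw']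
  refine lintegral_congr_ae (ae_restrict_of_ae ?_)
  filter_upwards [hw.tsum_eq] with x hx
  rw [ENNReal.tsum_mul_left, hx, mul_comm]

/-- Unfolding: both sides are the sum of the integrals of `w(x) w'(hx)` over `h ∈ H`. -/
lemma mul_setLIntegral_eq (hw : IsTiling μ H w C) (hw' : IsTiling μ H w' C')
    (hA : MeasurableSet A) (hinv : ∀ h ∈ H, ∀ x, h • x ∈ A ↔ x ∈ A) :
    C' * ∫⁻ x in A, w x ∂μ = C * ∫⁻ x in A, w' x ∂μ := by
  rw [hw'.mul_setLIntegral hw.measurable, hw.mul_setLIntegral hw'.measurable,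
    ← (Equiv.inv H).tsum_eq]
  refine tsum_congr fun h => ?_
  change ∫⁻ x in A, w x * w' ((h : G)⁻¹ • x) ∂μ = _
  rw [← (measurePreserving_smul (h : G) μ).setLIntegral_comp_preimage hA
    (f := fun x => w x * w' ((h : G)⁻¹ • x))
    (hw.measurable.mul (hw'.measurable.comp (measurable_const_smul _)))]
  have hAh : (fun x => (h : G) • x) ⁻¹' A = A := Set.ext fun x => hinv h h.2 x
  simp only [hAh, inv_smul_smul, mul_comm (w _)]
  rfl

lemma mul_withDensity_apply_eq (hw : IsTiling μ H w C) (hw' : IsTiling μ H w' C')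
    (hA : MeasurableSet A) (hinv : ∀ h ∈ H, ∀ x, h • x ∈ A ↔ x ∈ A) :
    C' * μ.withDensity w A = C * μ.withDensity w' A := by
  rw [withDensity_apply _ hA, withDensity_apply _ hA]
  exact hw.mul_setLIntegral_eq hw' hA hinv

lemma map_withDensity_eq (hw : IsTiling μ H w C) (hw' : IsTiling μ H w' C') (hC : C ≠ 0)
    (hC_top : C ≠ ∞) {Y : Type*} [MeasurableSpace Y] {F : X → Y} (hF : Measurable F)
    (hinv : ∀ h ∈ H, ∀ x, F (h • x) = F x) :
    (μ.withDensity w').map F = (C' / C) • (μ.withDensity w).map F := by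
  ext s hs
  rw [Measure.smul_apply, Measure.map_apply hF hs, Measure.map_apply hF hs, smul_eq_mul,
    ENNReal.div_eq_inv_mul, mul_assoc, hw.mul_withDensity_apply_eq hw' (hF hs)
      fun h hh x => by simp only [Set.mem_preimage, hinv h hh], ← mul_assoc,
    ENNReal.inv_mul_cancel hC hC_top, one_mul]

lemma average_eq (hw : IsTiling μ H w C) (hw' : IsTiling μ H w' C') (hC : C ≠ 0)
    (hC_top : C ≠ ∞) [IsFiniteMeasure (μ.withDensity w')] [NeZero (μ.withDensity w')]
    {E : Type*} [NormedAddCommGroup E] [NormedSpace ℝ E] [MeasurableSpace E] [BorelSpace E]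
    [SecondCountableTopology E] {F : X → E} (hF : Measurable F)
    (hinv : ∀ h ∈ H, ∀ x, F (h • x) = F x) :
    ⨍ x, F x ∂μ.withDensity w' = ⨍ x, F x ∂μ.withDensity w := by
  have hmap := hw.map_withDensity_eq hw' hC hC_top hF hinv
  have huniv : μ.withDensity w' Set.univ = C' / C * μ.withDensity w Set.univ := by
    simpa [Measure.map_apply hF .univ] using congrArg (· Set.univ) hmap
  have hscale : (C' / C).toReal ≠ 0 := by
    have hne : C' / C * μ.withDensity w Set.univ ≠ 0 :=
      huniv ▸ Measure.measure_univ_ne_zero.mpr (NeZero.ne _)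
    refine ENNReal.toReal_ne_zero.mpr ⟨left_ne_zero_of_mul hne, fun h => ?_⟩
    exact measure_ne_top _ _ (huniv.trans (by rw [h, ENNReal.top_mul (right_ne_zero_of_mul hne)]))
  rw [MeasureTheory.average_eq, MeasureTheory.average_eq, Measure.real, huniv, ENNReal.toReal_mul,
    ← integral_map (φ := F) (f := fun y => y) hF.aemeasurable measurable_id.aestronglyMeasurable,
    hmap, integral_smul_measure,
    integral_map (f := fun y => y) hF.aemeasurable measurable_id.aestronglyMeasurable, smul_smul,
    mul_inv, mul_right_comm, inv_mul_cancel₀ hscale, one_mul, Measure.real]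

end IsTiling

end Tilings

section FundamentalDomain

lemma volume_eq_zero_iff {s : Set ℍ} : volume s = 0 ↔ volume ((↑) '' s : Set ℂ) = 0 := by
  rw [← measurableEmbedding_coe.comap_apply, volume_def]
  have hcont : Continuous fun z : ℍ => (1 / NNReal.mk z.im z.im_pos.le) ^ 2 := by
    refine .pow (.div₀ continuous_const ?_ fun z => NNReal.ne_iff.mp z.im_ne_zero) 2
    exact continuous_im.subtype_mk _
  refine ⟨fun h => withDensity_absolutelyContinuous'
    hcont.measurable.coe_nnreal_ennreal.aemeasurable (.of_forall fun z => ?_) h,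
    fun h => withDensity_absolutelyContinuous _ _ h⟩
  have him : NNReal.mk z.im z.im_pos.le ≠ 0 := NNReal.ne_iff.mp z.im_ne_zero
  exact ENNReal.coe_ne_zero.mpr (pow_ne_zero 2 (one_div_ne_zero him))

lemma volume_re_eq (c : ℝ) : volume {z : ℂ | z.re = c} = 0 := by
  have h : {z : ℂ | z.re = c} = Complex.measurableEquivRealProd ⁻¹' ({c} ×ˢ Set.univ) := by
    ext z
    simp [Complex.measurableEquivRealProd]
  rw [h, Complex.volume_preserving_equiv_real_prod.measure_preimage_equiv, Measure.volume_eq_prod,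
    Measure.prod_prod, Real.volume_singleton, zero_mul]

lemma fd_diff_fdo_subset : ((↑) '' (ModularGroup.fd \ ModularGroup.fdo) : Set ℂ) ⊆
    Metric.sphere 0 1 ∪ ({z | z.re = 1 / 2} ∪ {z | z.re = -(1 / 2)}) := by
  rintro _ ⟨z, ⟨⟨hnorm, hre⟩, hfdo⟩, rfl⟩
  by_cases h : |z.re| = 1 / 2
  · exact Or.inr ((abs_eq (by norm_num)).mp h)
  · have h1 : ¬ 1 < Complex.normSq (z : ℂ) := fun h' => hfdo ⟨h', lt_of_le_of_ne hre h⟩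
    have h2 : ‖(z : ℂ)‖ ^ 2 = 1 := by
      rw [← Complex.normSq_eq_norm_sq, le_antisymm (not_lt.mp h1) hnorm]
    exact Or.inl (by simpa using (pow_eq_one_iff_of_nonneg (norm_nonneg _) two_ne_zero).mp h2)

lemma volume_fd_diff_fdo : volume (ModularGroup.fd \ ModularGroup.fdo) = 0 := by
  refine volume_eq_zero_iff.mpr (measure_mono_null fd_diff_fdo_subset ?_)
  rw [measure_union_null_iff, measure_union_null_iff]
  exact ⟨Measure.addHaar_sphere volume _ _, volume_re_eq _, volume_re_eq _⟩

lemma volume_strip_lt_top (a b : ℝ) {c : ℝ} (hc : 0 < c) :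
    volume {z : ℍ | z.re ∈ Set.Icc a b ∧ c < z.im} < ∞ := by
  have hy : ∫⁻ y in Set.Ioi c, (((1 / ‖y‖₊) ^ 2 : NNReal) : ℝ≥0∞) < ∞ := by
    refine lt_of_eq_of_lt (setLIntegral_congr_fun measurableSet_Ioi fun y hy => ?_)
      (integrableOn_Ioi_rpow_of_lt (a := -2) (by norm_num) hc).2
    change _ = ‖y ^ (-2 : ℝ)‖ₑ
    rw [Real.rpow_neg (hc.trans hy).le, enorm_eq_nnnorm]
    simp
  calc
    _ ≤ ∫⁻ z in Complex.measurableEquivRealProd ⁻¹' (Set.Icc a b ×ˢ Set.Ioi c),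
          (((1 / ‖z.im‖₊) ^ 2 : NNReal) : ℝ≥0∞) := by
      rw [UpperHalfPlane.volume_eq_lintegral]
      refine lintegral_mono_set ?_
      rintro _ ⟨z, hz, rfl⟩
      exact hz
    _ = ∫⁻ p in Set.Icc a b ×ˢ Set.Ioi c, (((1 / ‖p.2‖₊) ^ 2 : NNReal) : ℝ≥0∞) :=
      Complex.volume_preserving_equiv_real_prod.setLIntegral_comp_preimage_emb
        Complex.measurableEquivRealProd.measurableEmbedding
        (fun p : ℝ × ℝ => (((1 / ‖p.2‖₊) ^ 2 : NNReal) : ℝ≥0∞)) _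
    _ = volume (Set.Icc a b) * ∫⁻ y in Set.Ioi c, (((1 / ‖y‖₊) ^ 2 : NNReal) : ℝ≥0∞) := by
      rw [Measure.volume_eq_prod, ← Measure.prod_restrict, lintegral_prod _ (by fun_prop)]
      simp [mul_comm]
    _ < ∞ := ENNReal.mul_lt_top measure_Icc_lt_top hy

lemma volume_fd_lt_top : volume ModularGroup.fd < ∞ := by
  refine (volume_strip_lt_top (-(1 / 2)) (1 / 2) (c := 1 / 2) (by norm_num)).trans_le'
    (measure_mono fun z hz => ⟨abs_le.mp hz.2, ?_⟩)
  nlinarith [z.im_pos, ModularGroup.three_le_four_mul_im_sq_of_mem_fd hz]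

lemma volume_fd_ne_zero : volume ModularGroup.fd ≠ 0 := by
  have hopen : IsOpen ((↑) '' ModularGroup.fdo : Set ℂ) :=
    isOpenEmbedding_coe.isOpenMap _ ModularGroup.isOpen_fdo
  have hne : ((↑) '' ModularGroup.fdo : Set ℂ).Nonempty := by
    rw [ModularGroup.coe_fdo]
    exact ⟨2 * Complex.I, by simp, by simp, by simp⟩
  exact fun h => (hopen.measure_pos volume hne).ne' <|
    volume_eq_zero_iff.mp (measure_mono_null ModularGroup.fdo_subset_fd h)

instance : SMulInvariantMeasure SL(2, ℤ) ℍ volume where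
  measure_preimage_smul g s _ :=
    measure_preimage_smul volume (Matrix.SpecialLinearGroup.mapGL ℝ g) s

instance : MeasurableConstSMul SL(2, ℤ) ℍ where
  measurable_const_smul g :=
    (continuous_const_smul (Matrix.SpecialLinearGroup.mapGL ℝ g)).measurable

instance : Countable SL(2, ℤ) :=
  have : Countable (Matrix (Fin 2) (Fin 2) ℤ) := inferInstanceAs (Countable (Fin 2 → Fin 2 → ℤ))
  Subtype.countable

lemma smul_mem_fd_iff {z : ℍ} {g₀ : SL(2, ℤ)} (hg₀ : g₀ • z ∈ ModularGroup.fdo) (g : SL(2, ℤ)) :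
    g • z ∈ ModularGroup.fd ↔ g ∈ ({g₀, -g₀} : Finset SL(2, ℤ)) := by
  rw [Finset.mem_insert, Finset.mem_singleton]
  constructor
  · intro hg
    have hmem : (g * g₀⁻¹) • g₀ • z ∈ ModularGroup.fd := by rwa [smul_smul, inv_mul_cancel_right]
    rcases ModularGroup.eq_one_or_neg_one_of_mem_fdo_mem_fd hg₀ hmem with h | h
    · exact Or.inl (mul_inv_eq_one.mp h)
    · exact Or.inr (by simpa using mul_inv_eq_iff_eq_mul.mp h)
  · rintro (rfl | rfl)
    · exact ModularGroup.fdo_subset_fd hg₀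
    · rw [ModularGroup.SL_neg_smul]
      exact ModularGroup.fdo_subset_fd hg₀

lemma SL_ne_neg (g : SL(2, ℤ)) : g ≠ -g := by
  intro h
  have hzero : (g : Matrix (Fin 2) (Fin 2) ℤ) = 0 :=
    Matrix.ext fun i j => self_eq_neg.mp (congrArg (fun γ : SL(2, ℤ) => γ i j) h)
  simpa [hzero] using g.det_coe

lemma tsum_indicator_fd :
    ∀ᵐ z : ℍ, ∑' g : SL(2, ℤ), ModularGroup.fd.indicator (1 : ℍ → ℝ≥0∞) (g • z) = 2 := by
  have hN : ∀ᵐ z : ℍ, ∀ g : SL(2, ℤ), g • z ∉ ModularGroup.fd \ ModularGroup.fdo :=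
    ae_all_iff.mpr fun g => (measurePreserving_smul g volume).quasiMeasurePreserving.ae
      (measure_eq_zero_iff_ae_notMem.mp volume_fd_diff_fdo)
  filter_upwards [hN] with z hz
  obtain ⟨g₀, hg₀⟩ := ModularGroup.exists_smul_mem_fd z
  have hmem := smul_mem_fd_iff (by_contra fun h => hz g₀ ⟨hg₀, h⟩ : g₀ • z ∈ ModularGroup.fdo)
  have hone : ∀ g ∈ ({g₀, -g₀} : Finset SL(2, ℤ)),
      ModularGroup.fd.indicator (1 : ℍ → ℝ≥0∞) (g • z) = 1 :=
    fun g hg => Set.indicator_of_mem ((hmem g).mpr hg) _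
  rw [tsum_eq_sum fun g hg => Set.indicator_of_notMem (fun h => hg ((hmem g).mp h)) _,
    Finset.sum_congr rfl hone, Finset.sum_const, Finset.card_pair (SL_ne_neg g₀)]
  norm_num

end FundamentalDomain

section LevelMean

open Matrix.SpecialLinearGroup

/-- The density that counts how many translates of the standard fundamental domain of `SL₂(ℤ)` by
inverses of coset representatives of `SL₂(ℤ) / Γ` contain a given point. Up to a null set this is
the indicator function of a fundamental domain of `Γ` if `-1 ∈ Γ`, and is twice as large on average
otherwise. -/
def cosetDensity (Γ : Subgroup SL(2, ℤ)) (z : ℍ) : ℝ≥0∞ :=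
  ∑' c : SL(2, ℤ) ⧸ Γ, ModularGroup.fd.indicator 1 (c.out • z)

/-- The hyperbolic measure carried by the translates of the standard fundamental domain that are
counted by `cosetDensity Γ`. -/
def cosetMeasure (Γ : Subgroup SL(2, ℤ)) : Measure ℍ :=
  volume.withDensity (cosetDensity Γ)

/-- The mean value of a `Γ`-invariant function over `Γ \ ℍ` for the hyperbolic measure. -/
def levelMean (Γ : Subgroup SL(2, ℤ)) (F : ℍ → ℂ) : ℂ :=
  ⨍ z, F z ∂cosetMeasure Γ

variable (Γ : Subgroup SL(2, ℤ))

instance : Countable (SL(2, ℤ) ⧸ Γ) := inferInstanceAs (Countable (Quotient _))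

instance : Countable (Γ.map (mapGL ℝ)) :=
  (Γ.equivMapOfInjective _ (mapGL_injective (S := ℝ))).symm.injective.countable

lemma measurable_indicator_fd : Measurable (ModularGroup.fd.indicator (1 : ℍ → ℝ≥0∞)) :=
  measurable_one.indicator ModularGroup.isClosed_fd.measurableSet

lemma isTiling_cosetDensity :
    IsTiling (volume : Measure ℍ) (Γ.map (mapGL ℝ)) (cosetDensity Γ) 2 where
  measurable := Measurable.tsum fun _ => measurable_indicator_fd.comp (measurable_const_smul _)
  tsum_eq := by
    filter_upwards [tsum_indicator_fd] with z hz
    rw [← hz, tsum_eq_tsum_cosets Γ,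
      ← (Γ.equivMapOfInjective _ (mapGL_injective (S := ℝ))).toEquiv.tsum_eq, ENNReal.tsum_comm]
    refine tsum_congr fun h => tsum_congr fun c => ?_
    rw [mul_smul]
    rfl

lemma cosetMeasure_eq_sum : cosetMeasure Γ =
    Measure.sum fun c : SL(2, ℤ) ⧸ Γ => volume.restrict ((c.out • ·) ⁻¹' ModularGroup.fd) := by
  have h : cosetDensity Γ = ∑' c : SL(2, ℤ) ⧸ Γ,
      ((c.out • ·) ⁻¹' ModularGroup.fd).indicator (1 : ℍ → ℝ≥0∞) := by
    ext z
    rw [ENNReal.tsum_apply]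
    rfl
  have hm (c : SL(2, ℤ) ⧸ Γ) : MeasurableSet ((c.out • ·) ⁻¹' ModularGroup.fd : Set ℍ) :=
    measurable_const_smul _ ModularGroup.isClosed_fd.measurableSet
  rw [cosetMeasure, h, withDensity_tsum fun c => measurable_one.indicator (hm c)]
  exact congrArg _ (funext fun c => withDensity_indicator_one (hm c))

lemma cosetMeasure_univ : cosetMeasure Γ Set.univ =
    ∑' _ : SL(2, ℤ) ⧸ Γ, volume ModularGroup.fd := by
  rw [cosetMeasure_eq_sum, Measure.sum_apply _ .univ]
  refine tsum_congr fun c => ?_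
  rw [Measure.restrict_apply_univ, measure_preimage_smul]

instance : NeZero (cosetMeasure Γ) where
  out := by
    rw [← Measure.measure_univ_ne_zero, cosetMeasure_univ, Ne, ENNReal.tsum_eq_zero]
    exact fun h => volume_fd_ne_zero (h (QuotientGroup.mk 1))

instance [Γ.FiniteIndex] : IsFiniteMeasure (cosetMeasure Γ) where
  measure_univ_lt_top := by
    have := Fintype.ofFinite (SL(2, ℤ) ⧸ Γ)
    rw [cosetMeasure_univ, tsum_fintype]
    exact ENNReal.sum_lt_top.mpr fun _ _ => volume_fd_lt_top

lemma integral_cosetMeasure [Γ.FiniteIndex] {F : ℍ → ℂ} (hF : Integrable F (cosetMeasure Γ)) :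
    ∫ z, F z ∂cosetMeasure Γ =
      ∑ᶠ c : SL(2, ℤ) ⧸ Γ, ∫ z in ModularGroup.fd, F (c.out⁻¹ • z) := by
  have := Fintype.ofFinite (SL(2, ℤ) ⧸ Γ)
  rw [cosetMeasure_eq_sum] at hF ⊢
  rw [Measure.sum_fintype] at hF ⊢
  rw [finsum_eq_sum_of_fintype, integral_finsetSum_measure fun c hc => ?_]
  · refine Finset.sum_congr rfl fun c _ => ?_
    rw [← (measurePreserving_smul c.out (volume : Measure ℍ)).setIntegral_preimage_emb
      (measurableEmbedding_const_smul _) (fun z => F (c.out⁻¹ • z))]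
    simp only [inv_smul_smul]
  · exact integrable_finsetSum_measure.mp hF c hc

variable {Γ}

lemma map_smul_cosetMeasure (β : GL (Fin 2) ℝ) : (cosetMeasure Γ).map (β • ·) =
    volume.withDensity fun z => cosetDensity Γ (β⁻¹ • z) := by
  have hm : Measurable (fun z : ℍ => β • z) := measurable_const_smul β
  ext s hs
  rw [Measure.map_apply hm hs, cosetMeasure, withDensity_apply _ (hm hs), withDensity_apply _ hs,
    ← (measurePreserving_smul β (volume : Measure ℍ)).setLIntegral_comp_preimage hs
      (f := fun z => cosetDensity Γ (β⁻¹ • z))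
      ((isTiling_cosetDensity Γ).measurable.comp (measurable_const_smul _))]
  simp only [inv_smul_smul]

/-- Translating a tiling of `Γ'` by `β` gives a tiling of `βΓ'β⁻¹ ≤ Γ`, and the mean of a
`Γ`-invariant function can be computed with any tiling of a subgroup of `Γ`. -/
lemma levelMean_comp_smul {Γ' : Subgroup SL(2, ℤ)} [Γ'.FiniteIndex] (β : GL (Fin 2) ℝ)
    (hβ : ∀ γ ∈ Γ', β * mapGL ℝ γ * β⁻¹ ∈ Γ.map (mapGL ℝ)) {F : ℍ → ℂ} (hF : Measurable F)
    (hinv : ∀ γ ∈ Γ, ∀ z : ℍ, F (γ • z) = F z) :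
    levelMean Γ' (fun z => F (β • z)) = levelMean Γ F := by
  have hle : ConjAct.toConjAct β • Γ'.map (mapGL ℝ) ≤ Γ.map (mapGL ℝ) := by
    rintro _ ⟨_, ⟨γ, hγ, rfl⟩, rfl⟩
    exact hβ γ hγ
  have htiling := ((isTiling_cosetDensity Γ').conjAct_smul β).of_le hle
  have hmap := map_smul_cosetMeasure (Γ := Γ') β
  have hβm := (measurable_const_smul (α := ℍ) β).aemeasurable (μ := cosetMeasure Γ')
  have : IsFiniteMeasure (volume.withDensity fun z => cosetDensity Γ' (β⁻¹ • z)) :=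
    hmap ▸ Measure.isFiniteMeasure_map _ _
  have : NeZero (volume.withDensity fun z => cosetDensity Γ' (β⁻¹ • z)) :=
    ⟨hmap ▸ (Measure.map_ne_zero_iff hβm).mpr (NeZero.ne _)⟩
  have hmean := (isTiling_cosetDensity Γ).average_eq htiling two_ne_zero ENNReal.ofNat_ne_top hF
    (by rintro _ ⟨γ, hγ, rfl⟩ z; exact hinv γ hγ z)
  rw [← hmap, MeasureTheory.average_eq, integral_map hβm hF.aestronglyMeasurable, Measure.real,
    Measure.map_apply_of_aemeasurable hβm .univ, Set.preimage_univ] at hmean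
  rwa [levelMean, MeasureTheory.average_eq]

end LevelMean

section Mean

open Matrix.SpecialLinearGroup

/-- The largest subgroup of `SL₂(ℤ)` under which `F` is invariant. -/
def invarianceGroup (F : ℍ → ℂ) : Subgroup SL(2, ℤ) where
  carrier := {γ | ∀ z : ℍ, F (γ • z) = F z}
  one_mem' z := by rw [one_smul]
  mul_mem' hγ hδ z := by rw [mul_smul, hγ, hδ]
  inv_mem' {γ} hγ z := by rw [← hγ, smul_inv_smul]

/-- The mean value of an automorphic function of arbitrary level over `ℍ`, that is, its mean over
`Γ \ ℍ` for any subgroup `Γ` of finite index in the invariance group. -/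
def mean (F : ℍ → ℂ) : ℂ :=
  levelMean (invarianceGroup F) F

/-- Bounded measurable functions on `ℍ` that are automorphic for some congruence subgroup, so that
their mean value over `ℍ` is meaningful. -/
structure IsBoundedAutomorphic (F : ℍ → ℂ) : Prop where
  measurable : Measurable F
  bounded : ∃ C : ℝ, ∀ z, ‖F z‖ ≤ C
  isCongruenceSubgroup : IsCongruenceSubgroup (invarianceGroup F)

lemma Gamma_le_Gamma_of_dvd {M N : ℕ} (h : M ∣ N) : Gamma N ≤ Gamma M := by
  intro γ hγ
  rw [Gamma_mem] at hγ ⊢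
  have hcast (a : ℤ) : ((a : ZMod N).cast : ZMod M) = a := ZMod.cast_intCast h a
  obtain ⟨h₀₀, h₀₁, h₁₀, h₁₁⟩ := hγ
  simp only [← hcast, h₀₀, h₀₁, h₁₀, h₁₁, ZMod.cast_one h, ZMod.cast_zero, and_self]

lemma isCongruenceSubgroup_inf {Γ Δ : Subgroup SL(2, ℤ)} (hΓ : IsCongruenceSubgroup Γ)
    (hΔ : IsCongruenceSubgroup Δ) : IsCongruenceSubgroup (Γ ⊓ Δ) := by
  obtain ⟨M, hM, hMΓ⟩ := hΓ
  obtain ⟨N, hN, hNΔ⟩ := hΔ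
  exact ⟨M * N, mul_ne_zero hM hN,
    le_inf ((Gamma_le_Gamma_of_dvd (dvd_mul_right M N)).trans hMΓ)
      ((Gamma_le_Gamma_of_dvd (dvd_mul_left N M)).trans hNΔ)⟩

variable {F G : ℍ → ℂ}

lemma mean_eq_levelMean {Γ : Subgroup SL(2, ℤ)} [Γ.FiniteIndex] (hF : Measurable F)
    (hΓ : Γ ≤ invarianceGroup F) : mean F = levelMean Γ F := by
  simpa [mean] using
    (levelMean_comp_smul 1 (fun γ hγ => ⟨γ, hΓ hγ, by simp⟩) hF fun γ hγ => hγ).symm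

/-- The embedding of `GL₂(ℚ)` into `GL₂(ℝ)`. -/
abbrev toReal : GL (Fin 2) ℚ →* GL (Fin 2) ℝ :=
  Matrix.GeneralLinearGroup.map (Rat.castHom ℝ)

lemma exists_conj_mem {Γ : Subgroup SL(2, ℤ)} (hΓ : IsCongruenceSubgroup Γ) (β : GL (Fin 2) ℚ) :
    ∃ Δ : Subgroup SL(2, ℤ), IsCongruenceSubgroup Δ ∧
      ∀ γ ∈ Δ, ∃ δ ∈ Γ, toReal β * mapGL ℝ γ = mapGL ℝ δ * toReal β := by
  obtain ⟨N, hN, hNΓ⟩ := hΓ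
  have : NeZero N := ⟨hN⟩
  obtain ⟨M, hM, hle⟩ := exists_Gamma_le_conj' β N
  have : NeZero M := ⟨hM⟩
  refine ⟨Gamma M, Gamma_is_cong_sub M, fun γ hγ => ?_⟩
  obtain ⟨δ, hδ, hconj⟩ := hle ⟨mapGL ℝ γ, ⟨γ, hγ, rfl⟩, rfl⟩
  exact ⟨δ, hNΓ hδ, (eq_mul_inv_iff_mul_eq.mp hconj).symm⟩

lemma mean_comp_smul (hF : IsBoundedAutomorphic F) (β : GL (Fin 2) ℚ) :
    mean (fun z => F (toReal β • z)) = mean F := by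
  obtain ⟨Δ, hΔ, hconj⟩ := exists_conj_mem hF.isCongruenceSubgroup β
  have := hΔ.finiteIndex
  have hinv : Δ ≤ invarianceGroup fun z => F (toReal β • z) := fun γ hγ z => by
    obtain ⟨δ, hδ, hγδ⟩ := hconj γ hγ
    change F (toReal β • mapGL ℝ γ • z) = _
    rw [smul_smul, hγδ, mul_smul]
    exact hδ _
  rw [mean_eq_levelMean (by exact hF.measurable.comp (measurable_const_smul _)) hinv]
  refine levelMean_comp_smul _ (fun γ hγ => ?_) hF.measurable fun γ hγ => hγ
  obtain ⟨δ, hδ, hγδ⟩ := hconj γ hγ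
  exact ⟨δ, hδ, eq_mul_inv_of_mul_eq hγδ.symm⟩

lemma mean_add (hF : IsBoundedAutomorphic F) (hG : IsBoundedAutomorphic G) :
    mean (F + G) = mean F + mean G := by
  have hcong := isCongruenceSubgroup_inf hF.isCongruenceSubgroup hG.isCongruenceSubgroup
  have := hcong.finiteIndex
  obtain ⟨C, hC⟩ := hF.bounded
  obtain ⟨D, hD⟩ := hG.bounded
  rw [mean_eq_levelMean hF.measurable (inf_le_left (b := invarianceGroup G)),
    mean_eq_levelMean hG.measurable (inf_le_right (a := invarianceGroup F)),
    mean_eq_levelMean (hF.measurable.add hG.measurable)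
      fun γ (hγ : γ ∈ invarianceGroup F ⊓ invarianceGroup G) z =>
        congrArg₂ (· + ·) (hγ.1 z) (hγ.2 z)]
  exact integral_add
    ((Integrable.of_bound hF.measurable.aestronglyMeasurable C (.of_forall hC)).to_average)
    ((Integrable.of_bound hG.measurable.aestronglyMeasurable D (.of_forall hD)).to_average)

lemma mean_const_mul (c : ℂ) (hF : IsBoundedAutomorphic F) :
    mean (fun z => c * F z) = c * mean F := by
  have := hF.isCongruenceSubgroup.finiteIndex
  rw [mean_eq_levelMean (hF.measurable.const_mul c)
    fun γ (hγ : γ ∈ invarianceGroup F) z => congrArg (c * ·) (hγ z)]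
  exact integral_const_mul c F

lemma mean_conj (hF : IsBoundedAutomorphic F) :
    mean (fun z => conj (F z)) = conj (mean F) := by
  have := hF.isCongruenceSubgroup.finiteIndex
  rw [mean_eq_levelMean (by exact Complex.continuous_conj.measurable.comp hF.measurable)
    fun γ (hγ : γ ∈ invarianceGroup F) z => congrArg conj (hγ z)]
  exact integral_conj

end Mean

section BoundedForms

lemma norm_petersson (k : ℤ) (f g : ℍ → ℂ) (z : ℍ) :
    ‖petersson k f g z‖ = ‖f z‖ * ‖g z‖ * z.im ^ k := by
  simp [petersson, abs_of_pos z.im_pos]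

lemma norm_petersson_le (k : ℤ) (f g : ℍ → ℂ) (z : ℍ) :
    ‖petersson k f g z‖ ≤ ‖petersson k f f z‖ + ‖petersson k g g z‖ := by
  simp only [norm_petersson, ← add_mul]
  refine mul_le_mul_of_nonneg_right ?_ (zpow_pos z.im_pos k).le
  nlinarith [sq_nonneg (‖f z‖ - ‖g z‖), sq_nonneg (‖f z‖ + ‖g z‖)]

lemma norm_petersson_add_le (k : ℤ) (f g : ℍ → ℂ) (z : ℍ) :
    ‖petersson k (f + g) (f + g) z‖ ≤ 2 * (‖petersson k f f z‖ + ‖petersson k g g z‖) := by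
  simp only [norm_petersson, ← add_mul, ← mul_assoc]
  refine mul_le_mul_of_nonneg_right ?_ (zpow_pos z.im_pos k).le
  have hfg : ‖(f + g) z‖ ≤ ‖f z‖ + ‖g z‖ := norm_add_le _ _
  nlinarith [norm_nonneg ((f + g) z), sq_nonneg (‖f z‖ - ‖g z‖)]

/-- The space of continuous functions of weight `k` for some congruence subgroup such that
`|f(z)|² y ^ k` is bounded. It contains the cusp forms of all levels and is stable under the action
of `GL₂⁺(ℚ)`. -/
def boundedForms (k : ℤ) : Submodule ℂ (ℍ → ℂ) where
  carrier := {f | Continuous f ∧ (∃ Γ, IsCongruenceSubgroup Γ ∧ ∀ γ ∈ Γ, f ∣[k] γ = f) ∧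
    ∃ C : ℝ, ∀ z, ‖petersson k f f z‖ ≤ C}
  zero_mem' := ⟨continuous_zero, ⟨Gamma 1, Gamma_is_cong_sub 1, by simp⟩, 0, by simp [petersson]⟩
  add_mem' := by
    rintro f g ⟨hf, ⟨Γ, hΓ, hfΓ⟩, C, hC⟩ ⟨hg, ⟨Δ, hΔ, hgΔ⟩, D, hD⟩
    refine ⟨hf.add hg, ⟨Γ ⊓ Δ, isCongruenceSubgroup_inf hΓ hΔ, fun γ hγ => ?_⟩, 2 * (C + D),
      fun z => (norm_petersson_add_le k f g z).trans ?_⟩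
    · rw [SlashAction.add_slash, hfΓ γ hγ.1, hgΔ γ hγ.2]
    · linarith [hC z, hD z]
  smul_mem' := by
    rintro c f ⟨hf, ⟨Γ, hΓ, hfΓ⟩, C, hC⟩
    refine ⟨hf.const_smul c, ⟨Γ, hΓ, fun γ hγ => ?_⟩, ‖c‖ * ‖c‖ * C, fun z => ?_⟩
    · rw [ModularForm.SL_smul_slash, hfΓ γ hγ]
    · have hfz := mul_le_mul_of_nonneg_left (hC z) (mul_nonneg (norm_nonneg c) (norm_nonneg c))
      rw [norm_petersson] at hfz ⊢
      rw [Pi.smul_apply, norm_smul]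
      linarith

variable {k : ℤ}

lemma isBoundedAutomorphic_petersson (f g : boundedForms k) :
    IsBoundedAutomorphic (petersson k f g) := by
  obtain ⟨f, hf, ⟨Γ, hΓ, hfΓ⟩, C, hC⟩ := f
  obtain ⟨g, hg, ⟨Δ, hΔ, hgΔ⟩, D, hD⟩ := g
  refine ⟨(petersson_continuous k hf hg).measurable,
    ⟨C + D, fun z => (norm_petersson_le k f g z).trans (add_le_add (hC z) (hD z))⟩,
    isCongruenceSubgroup_trans _ _ (fun γ hγ z => ?_) (isCongruenceSubgroup_inf hΓ hΔ)⟩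
  rw [← petersson_slash_SL, hfΓ γ hγ.1, hgΔ γ hγ.2]

/-- The Petersson product of automorphic functions of arbitrary level, for the hyperbolic
measure normalised to have total mass one. -/
def pairing (k : ℤ) : boundedForms k →ₗ⋆[ℂ] boundedForms k →ₗ[ℂ] ℂ :=
  LinearMap.mk₂'ₛₗ (starRingEnd ℂ) (RingHom.id ℂ) (fun f g => mean (petersson k f g))
    (fun f g h => by
      rw [← mean_add (isBoundedAutomorphic_petersson f h) (isBoundedAutomorphic_petersson g h)]
      congr 1
      ext z
      simp [petersson, add_mul])
    (fun c f g => by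
      rw [smul_eq_mul, ← mean_const_mul _ (isBoundedAutomorphic_petersson f g)]
      congr 1
      ext z
      simp [petersson, mul_assoc])
    (fun f g h => by
      rw [← mean_add (isBoundedAutomorphic_petersson f g) (isBoundedAutomorphic_petersson f h)]
      congr 1
      ext z
      simp [petersson, mul_add, add_mul])
    (fun c f g => by
      rw [smul_eq_mul, RingHom.id_apply, ← mean_const_mul c (isBoundedAutomorphic_petersson f g)]
      congr 1
      ext z
      simp only [petersson, Submodule.coe_smul, Pi.smul_apply, smul_eq_mul]
      ring)

lemma pairing_apply (f g : boundedForms k) : pairing k f g = mean (petersson k f g) :=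
  rfl

lemma conj_pairing (f g : boundedForms k) : conj (pairing k f g) = pairing k g f := by
  rw [pairing_apply, ← mean_conj (isBoundedAutomorphic_petersson f g), pairing_apply]
  congr 1
  ext z
  rw [← petersson_symm]

end BoundedForms

section UnitarySlash

variable {k : ℤ}

lemma det_toReal (β : GL (Fin 2) ℚ) : (toReal β).det.val = (β.det.val : ℚ) := by
  simp [toReal, Matrix.det_fin_two]

lemma det_toReal_pos (β : GL(2, ℚ)⁺) : 0 < (toReal β).det.val := by
  rw [det_toReal]
  exact_mod_cast β.2

lemma slash_apply_of_det_pos {β : GL (Fin 2) ℝ} (hβ : 0 < β.det.val) (f : ℍ → ℂ) (z : ℍ) :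
    (f ∣[k] β) z = f (β • z) * (β.det.val : ℂ) ^ (k - 1) * denom β z ^ (-k) := by
  rw [ModularForm.slash_apply, σ, if_pos hβ, abs_of_pos hβ]
  rfl

lemma continuous_slash {f : ℍ → ℂ} (hf : Continuous f) {β : GL (Fin 2) ℝ} (hβ : 0 < β.det.val) :
    Continuous (f ∣[k] β) := by
  rw [show f ∣[k] β = _ from funext fun z => slash_apply_of_det_pos hβ f z]
  refine ((hf.comp (continuous_const_smul β)).mul continuous_const).mul
    (Continuous.zpow₀ ?_ _ fun z => Or.inl (denom_ne_zero β z))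
  unfold denom
  fun_prop

/-- The slash action of weight `k` with the power of the determinant that makes it unitary for
the Petersson product. -/
def unitarySlash (k : ℤ) (β : GL(2, ℚ)⁺) (f : ℍ → ℂ) : ℍ → ℂ :=
  (((toReal β).det.val ^ (1 - k / 2 : ℝ) : ℝ) : ℂ) • (f ∣[k] toReal β)

lemma unitarySlash_mul (α β : GL(2, ℚ)⁺) (f : ℍ → ℂ) :
    unitarySlash k (α * β) f = unitarySlash k β (unitarySlash k α f) := by
  rw [unitarySlash, unitarySlash, unitarySlash, ModularForm.smul_slash, σ,
    if_pos (det_toReal_pos β), smul_smul, Subgroup.coe_mul, map_mul, SlashAction.slash_mul, map_mul,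
    Units.val_mul, Real.mul_rpow (det_toReal_pos α).le (det_toReal_pos β).le, mul_comm]
  simp

lemma petersson_unitarySlash (β : GL(2, ℚ)⁺) (f g : ℍ → ℂ) (z : ℍ) :
    petersson k (unitarySlash k β f) (unitarySlash k β g) z = petersson k f g (toReal β • z) := by
  have hdet := det_toReal_pos β
  set D := (toReal β).det.val
  have hscalar : ((D ^ (1 - k / 2 : ℝ) : ℝ) : ℂ) ^ 2 * (D : ℂ) ^ (k - 2) = 1 := by
    rw [← Complex.ofReal_pow, ← Complex.ofReal_zpow, ← Complex.ofReal_mul, ← Real.rpow_natCast,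
      ← Real.rpow_mul hdet.le, ← Real.rpow_intCast, ← Real.rpow_add hdet]
    norm_num [show (1 - k / 2 : ℝ) * 2 + (k - 2) = 0 by ring]
  calc petersson k (unitarySlash k β f) (unitarySlash k β g) z
      = ((D ^ (1 - k / 2 : ℝ) : ℝ) : ℂ) ^ 2 *
          petersson k (f ∣[k] toReal β) (g ∣[k] toReal β) z := by
        simp only [petersson, unitarySlash, Pi.smul_apply, smul_eq_mul, map_mul,
          Complex.conj_ofReal]
        ring
    _ = petersson k f g (toReal β • z) := by
        rw [petersson_slash, σ, if_pos hdet, abs_of_pos hdet, ← mul_assoc, hscalar, one_mul]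
        rfl

lemma unitarySlash_mem (β : GL(2, ℚ)⁺) {f : ℍ → ℂ} (hf : f ∈ boundedForms k) :
    unitarySlash k β f ∈ boundedForms k := by
  obtain ⟨hcont, ⟨Γ, hΓ, hfΓ⟩, C, hC⟩ := hf
  refine ⟨(continuous_slash hcont (det_toReal_pos β)).const_smul _, ?_, C, fun z => ?_⟩
  · obtain ⟨Δ, hΔ, hconj⟩ := exists_conj_mem hΓ (β : GL (Fin 2) ℚ)
    refine ⟨Δ, hΔ, fun γ hγ => ?_⟩
    obtain ⟨δ, hδ, hγδ⟩ := hconj γ hγ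
    rw [unitarySlash, ModularForm.SL_smul_slash, ModularForm.SL_slash, ← SlashAction.slash_mul]
    exact congrArg _ ((congrArg (f ∣[k] ·) hγδ).trans
      ((SlashAction.slash_mul _ _ _ _).trans (congrArg (· ∣[k] _) (hfΓ δ hδ))))
  · rw [petersson_unitarySlash]
    exact hC _

/-- The unitary right action of `GL₂⁺(ℚ)` on bounded automorphic functions. -/
def slashOp (k : ℤ) (β : GL(2, ℚ)⁺) : Module.End ℂ (boundedForms k) where
  toFun f := ⟨unitarySlash k β f, unitarySlash_mem β f.2⟩
  map_add' f g := Subtype.ext <| by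
    simp only [unitarySlash, Submodule.coe_add, SlashAction.add_slash, smul_add]
  map_smul' c f := Subtype.ext <| by
    simp only [unitarySlash, Submodule.coe_smul, ModularForm.smul_slash, σ,
      if_pos (det_toReal_pos β), smul_comm c, RingHom.id_apply, ContinuousAlgEquiv.refl_apply]

lemma coe_slashOp (β : GL(2, ℚ)⁺) (f : boundedForms k) :
    (slashOp k β f : ℍ → ℂ) = unitarySlash k β f :=
  rfl

lemma slashOp_mul (α β : GL(2, ℚ)⁺) (f : boundedForms k) :
    slashOp k (α * β) f = slashOp k β (slashOp k α f) :=
  Subtype.ext (unitarySlash_mul α β f)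

lemma pairing_slashOp (β : GL(2, ℚ)⁺) (f g : boundedForms k) :
    pairing k (slashOp k β f) (slashOp k β g) = pairing k f g := by
  rw [pairing_apply, pairing_apply,
    ← mean_comp_smul (isBoundedAutomorphic_petersson f g) (β : GL (Fin 2) ℚ)]
  exact congrArg mean (funext fun z => petersson_unitarySlash β f g z)

end UnitarySlash

section CyclicMean

lemma sum_range_mul_of_periodic {A : Type*} [AddCommMonoid A] {n : ℕ} {v : ℕ → A}
    (hv : Function.Periodic v n) (m : ℕ) :
    ∑ i ∈ Finset.range (m * n), v i = m • ∑ i ∈ Finset.range n, v i := by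
  induction m with
  | zero => simp
  | succ m ih =>
    have hshift (i : ℕ) : v (m * n + i) = v i := by
      rw [add_comm]
      exact hv.nat_mul m i
    simp only [Nat.succ_mul, Finset.sum_range_add, ih, hshift, succ_nsmul]

lemma sum_range_comp_mul_of_periodic {A : Type*} [AddCommMonoid A] {p n : ℕ}
    (hpn : p.Coprime n) {v : ℕ → A} (hv : Function.Periodic v n) :
    ∑ i ∈ Finset.range n, v (p * i) = ∑ i ∈ Finset.range n, v i := by
  have hmaps : ∀ i ∈ Finset.range n, p * i % n ∈ Finset.range n := fun i hi =>
    Finset.mem_range.mpr (Nat.mod_lt _ (Nat.zero_lt_of_lt (Finset.mem_range.mp hi)))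
  have hinj : Set.InjOn (fun i => p * i % n) (Finset.range n) := fun i hi j hj hij =>
    (Nat.ModEq.cancel_left_of_coprime hpn.symm hij).eq_of_lt_of_lt
      (Finset.mem_range.mp hi) (Finset.mem_range.mp hj)
  exact Finset.sum_nbij _ hmaps hinj
    (Finset.surjOn_of_injOn_of_card_le _ hmaps hinj le_rfl) fun i _ => (hv.map_mod_nat _).symm

variable {M M' : Type*} [AddCommGroup M] [Module ℂ M] [AddCommGroup M'] [Module ℂ M']

/-- The mean value of a function of period one at the `n` points `i / n` of `ℚ / ℤ`. -/
def cyclicMean (n : ℕ) (u : ℚ → M) : M :=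
  (n : ℂ)⁻¹ • ∑ i ∈ Finset.range n, u (i / n)

lemma map_cyclicMean (T : M →ₗ[ℂ] M') (n : ℕ) (u : ℚ → M) :
    T (cyclicMean n u) = cyclicMean n fun t => T (u t) := by
  rw [cyclicMean, map_smul, map_sum, cyclicMean]

lemma cyclicMean_one (u : ℚ → M) : cyclicMean 1 u = u 0 := by
  simp [cyclicMean]

lemma cyclicMean_mul_of_periodic {p n : ℕ} (hp : p ≠ 0) (hpn : p.Coprime n) {u : ℚ → M}
    (hu : Function.Periodic u (1 / p)) : cyclicMean (p * n) u = cyclicMean n u := by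
  rcases eq_or_ne n 0 with rfl | hn
  · rw [mul_zero]
  have hp' : (p : ℚ) ≠ 0 := Nat.cast_ne_zero.mpr hp
  have hn' : (n : ℚ) ≠ 0 := Nat.cast_ne_zero.mpr hn
  have hv : Function.Periodic (fun i : ℕ => u (i / (p * n : ℕ))) n := fun i => by
    refine Eq.trans (congrArg u ?_) (hu (i / (p * n : ℕ)))
    push_cast
    field_simp
  have hpi (i : ℕ) : ((p * i : ℕ) : ℚ) / (p * n : ℕ) = i / n := by
    push_cast
    field_simp
  rw [cyclicMean, sum_range_mul_of_periodic hv, ← sum_range_comp_mul_of_periodic hpn hv, cyclicMean]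
  simp only [hpi]
  rw [← Nat.cast_smul_eq_nsmul ℂ, smul_smul, Nat.cast_mul, mul_comm (p : ℂ), mul_inv, mul_assoc,
    inv_mul_cancel₀ (Nat.cast_ne_zero.mpr hp), mul_one]

end CyclicMean

section RationalMatrices

open Matrix.SpecialLinearGroup

/-- The matrix `[1, x; 0, 1]`. -/
def upper (x : ℚ) : GL(2, ℚ)⁺ := toGLPos ⟨!![1, x; 0, 1], by simp⟩

/-- The matrix `[1, 0; y, 1]`. -/
def lower (y : ℚ) : GL(2, ℚ)⁺ := toGLPos ⟨!![1, 0; y, 1], by simp⟩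

/-- The matrix `[d, 0; 0, 1]`. -/
def scale (d : ℕ) [NeZero d] : GL(2, ℚ)⁺ :=
  ⟨Matrix.GeneralLinearGroup.mkOfDetNeZero !![(d : ℚ), 0; 0, 1] (by simp [NeZero.ne d]),
    by simp [Matrix.mem_glpos, Nat.pos_of_neZero]⟩

/-- The embedding of `SL₂(ℤ)` into `GL₂⁺(ℚ)`. -/
def ofInt : SL(2, ℤ) →* GL(2, ℚ)⁺ := toGLPos.comp (map (Int.castRingHom ℚ))

lemma GLPos_ext {α β : GL(2, ℚ)⁺}
    (h : ((α : GL (Fin 2) ℚ) : Matrix (Fin 2) (Fin 2) ℚ) = (β : GL (Fin 2) ℚ)) : α = β :=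
  Subtype.ext (Units.ext h)

lemma coe_upper (x : ℚ) : ((upper x : GL (Fin 2) ℚ) : Matrix (Fin 2) (Fin 2) ℚ) = !![1, x; 0, 1] :=
  rfl

lemma coe_lower (y : ℚ) : ((lower y : GL (Fin 2) ℚ) : Matrix (Fin 2) (Fin 2) ℚ) = !![1, 0; y, 1] :=
  rfl

lemma coe_scale (d : ℕ) [NeZero d] :
    ((scale d : GL (Fin 2) ℚ) : Matrix (Fin 2) (Fin 2) ℚ) = !![(d : ℚ), 0; 0, 1] :=
  rfl

lemma coe_ofInt (γ : SL(2, ℤ)) : ((ofInt γ : GL (Fin 2) ℚ) : Matrix (Fin 2) (Fin 2) ℚ) =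
    !![(γ 0 0 : ℚ), (γ 0 1 : ℚ); (γ 1 0 : ℚ), (γ 1 1 : ℚ)] :=
  Matrix.eta_fin_two _

lemma upper_add (x y : ℚ) : upper (x + y) = upper x * upper y :=
  GLPos_ext <| by simp [coe_upper, add_comm]

lemma lower_add (x y : ℚ) : lower (x + y) = lower x * lower y :=
  GLPos_ext <| by simp [coe_lower]

lemma scale_mul_upper (d : ℕ) [NeZero d] (x : ℚ) : scale d * upper x = upper (d * x) * scale d :=
  GLPos_ext <| by simp [coe_scale, coe_upper]

lemma scale_mul_lower (d : ℕ) [NeZero d] (y : ℚ) : scale d * lower (d * y) = lower y * scale d :=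
  GLPos_ext <| by simp [coe_scale, coe_lower, mul_comm]

lemma toReal_ofInt (γ : SL(2, ℤ)) : toReal (ofInt γ) = mapGL ℝ γ := by
  ext i j
  simp [toReal, ofInt]

lemma slashOp_ofInt {k : ℤ} (γ : SL(2, ℤ)) (f : boundedForms k) :
    (slashOp k (ofInt γ) f : ℍ → ℂ) = (f : ℍ → ℂ) ∣[k] γ := by
  rw [coe_slashOp, unitarySlash, toReal_ofInt, show (mapGL ℝ γ).det.val = 1 by simp,
    Real.one_rpow, Complex.ofReal_one, one_smul]
  rfl

end RationalMatrices

section CuspForms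

variable {k N : ℕ}

lemma mem_Gamma0_iff_dvd {γ : SL(2, ℤ)} : γ ∈ Gamma0 N ↔ (N : ℤ) ∣ γ 1 0 := by
  rw [Gamma0_mem, ZMod.intCast_zmod_eq_zero_iff_dvd]

lemma slash_Gamma0 (f : CuspSpace k N) {γ : SL(2, ℤ)} (hγ : γ ∈ Gamma0 N) :
    (f : ℍ → ℂ) ∣[(k : ℤ)] γ = f :=
  SlashInvariantFormClass.slash_action_eq f _ ⟨γ, hγ, rfl⟩

/-- A cusp form as an element of the space of bounded automorphic functions, on which all of
`GL₂⁺(ℚ)` acts. -/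
def toBoundedForms [NeZero N] : CuspSpace k N →ₗ[ℂ] boundedForms (k : ℤ) where
  toFun f := ⟨f, ModularFormClass.continuous f, ⟨Gamma0 N, Gamma0_is_congruence N,
    fun _ => slash_Gamma0 f⟩, CuspFormClass.petersson_bounded_left k _ f f⟩
  map_add' _ _ := rfl
  map_smul' _ _ := rfl

lemma coe_toBoundedForms [NeZero N] (f : CuspSpace k N) : (toBoundedForms f : ℍ → ℂ) = f :=
  rfl

lemma slashOp_toBoundedForms [NeZero N] (f : CuspSpace k N) {γ : SL(2, ℤ)} (hγ : γ ∈ Gamma0 N) :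
    slashOp k (ofInt γ) (toBoundedForms f) = toBoundedForms f :=
  Subtype.ext <| (slashOp_ofInt γ _).trans <| slash_Gamma0 f hγ

lemma inner_eq_pairing [NeZero N] (V : ℝ) (f g : CuspSpace k N) :
    inner V f g = V * pairing k (toBoundedForms f) (toBoundedForms g) := by
  have hF : IsBoundedAutomorphic (petersson k f g) :=
    isBoundedAutomorphic_petersson (toBoundedForms f) (toBoundedForms g)
  obtain ⟨C, hC⟩ := hF.bounded
  have hinv : Gamma0 N ≤ invarianceGroup (petersson k f g) := fun γ hγ z => by
    rw [← petersson_slash_SL, slash_Gamma0 f hγ, slash_Gamma0 g hγ]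
  have hnum : quotientIntegral N (petersson k f g) =
      ∫ z, petersson k f g z ∂cosetMeasure (Gamma0 N) :=
    (integral_cosetMeasure _ (.of_bound hF.measurable.aestronglyMeasurable C (.of_forall hC))).symm
  have hden : quotientIntegral N (fun _ => 1) = (cosetMeasure (Gamma0 N)).real Set.univ := by
    rw [quotientIntegral, ← integral_cosetMeasure (Gamma0 N) (integrable_const 1)]
    simp
  rw [inner, hnum, hden, pairing_apply, coe_toBoundedForms, coe_toBoundedForms,
    mean_eq_levelMean hF.measurable hinv, levelMean, average_eq, Complex.real_smul]
  push_cast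
  ring

end CuspForms

section Trace

open Matrix.SpecialLinearGroup

lemma exists_cuspForm_eq_sum_slash {𝒢 ℋ : Subgroup (GL (Fin 2) ℝ)} {k : ℤ} {ι : Type*} [Fintype ι]
    (f : CuspForm 𝒢 k) (r : ι → ℋ) (hr : ∀ γ : ℋ, ∃! i, ((γ * (r i)⁻¹ : ℋ) : GL (Fin 2) ℝ) ∈ 𝒢) :
    ∃ ψ : CuspForm ℋ k, (ψ : ℍ → ℂ) = ∑ i, (f : ℍ → ℂ) ∣[k] (r i : GL (Fin 2) ℝ) := by
  let coset : ι → ℋ ⧸ 𝒢.subgroupOf ℋ := fun i => ((r i)⁻¹ : ℋ)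
  have hcoset : Function.Bijective coset := by
    refine (Function.bijective_iff_existsUnique _).mpr (QuotientGroup.mk_surjective.forall.mpr ?_)
    intro γ
    have hiff (i : ι) : coset i = γ ↔ ((γ⁻¹ * (r i)⁻¹ : ℋ) : GL (Fin 2) ℝ) ∈ 𝒢 := by
      rw [eq_comm, QuotientGroup.eq, Subgroup.mem_subgroupOf]
    simpa only [hiff] using hr γ⁻¹
  have : Finite (ℋ ⧸ 𝒢.subgroupOf ℋ) := Finite.of_surjective coset hcoset.2
  have : 𝒢.IsFiniteRelIndex ℋ := ⟨Subgroup.index_ne_zero_of_finite⟩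
  let := Fintype.ofFinite (ℋ ⧸ 𝒢.subgroupOf ℋ)
  refine ⟨CuspForm.trace ℋ f, ?_⟩
  rw [CuspForm.coe_trace]
  refine (hcoset.sum_comp (SlashInvariantForm.quotientFunc f)).symm.trans
    (Finset.sum_congr rfl fun i _ => ?_)
  exact (SlashInvariantForm.quotientFunc_mk f (r i)⁻¹).trans (by simp)

variable {k N q : ℕ}

lemma toReal_injective : Function.Injective toReal := fun α β h => by
  ext i j
  exact Rat.cast_injective (α := ℝ) (congrArg (fun γ : GL (Fin 2) ℝ => γ i j) h)

lemma exists_toBoundedForms_eq_sum_slashOp [NeZero N] [NeZero q] {ι : Type*} [Fintype ι]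
    (f : CuspSpace k N) (α : GL(2, ℚ)⁺) (r : ι → Gamma0 q)
    (hr : ∀ γ : Gamma0 q, ∃! i, ∃ δ ∈ Gamma0 N, α * ofInt (γ * (r i)⁻¹ : Gamma0 q) = ofInt δ * α) :
    ∃ ψ : CuspSpace k q, toBoundedForms ψ =
      ∑ i, slashOp k (α * ofInt (r i)) (toBoundedForms f) := by
  let toGamma0 : Gamma0 q ≃* (Gamma0 q : Subgroup (GL (Fin 2) ℝ)) :=
    (Gamma0 q).equivMapOfInjective (mapGL ℝ) mapGL_injective
  have hmem (γ : Gamma0 q) : mapGL ℝ γ.1 ∈ ConjAct.toConjAct (toReal α)⁻¹ •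
      (Gamma0 N : Subgroup (GL (Fin 2) ℝ)) ↔ ∃ δ ∈ Gamma0 N, α * ofInt γ = ofInt δ * α := by
    rw [Subgroup.mem_pointwise_smul_iff_inv_smul_mem, ← ConjAct.toConjAct_inv, inv_inv,
      ConjAct.toConjAct_smul, Subgroup.mem_map]
    refine exists_congr fun δ => and_congr_right fun _ => ?_
    rw [eq_mul_inv_iff_mul_eq, ← toReal_ofInt, ← toReal_ofInt, ← map_mul, ← map_mul,
      toReal_injective.eq_iff, ← Subgroup.coe_mul, ← Subgroup.coe_mul, Subtype.coe_inj, eq_comm]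
  obtain ⟨ψ, hψ⟩ := exists_cuspForm_eq_sum_slash (ℋ := Gamma0 q)
    (CuspForm.translate f (toReal α)) (fun i => toGamma0 (r i)) (toGamma0.surjective.forall.mpr
      fun γ => by
        convert hr γ using 2
        rw [← map_inv toGamma0, ← map_mul toGamma0]
        exact hmem _)
  refine ⟨(((toReal α).det.val ^ (1 - k / 2 : ℝ) : ℝ) : ℂ) • ψ, Subtype.ext ?_⟩
  rw [map_smul, Submodule.coe_smul, coe_toBoundedForms, hψ, Finset.smul_sum,
    Submodule.coe_sum]
  refine Finset.sum_congr rfl fun i _ => ?_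
  rw [slashOp_mul, slashOp_ofInt, coe_slashOp, unitarySlash, ModularForm.SL_smul_slash]
  rfl

end Trace

section Dilation

variable {k N q : ℕ}

/-- The matrix `[1, n; 0, 1]` with integral entries. -/
def upperInt (n : ℤ) : SL(2, ℤ) := ⟨!![1, n; 0, 1], by simp⟩

/-- The matrix `[1, 0; n, 1]` with integral entries. -/
def lowerInt (n : ℤ) : SL(2, ℤ) := ⟨!![1, 0; n, 1], by simp⟩

lemma coe_upperInt (n : ℤ) : (upperInt n : Matrix (Fin 2) (Fin 2) ℤ) = !![1, n; 0, 1] :=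
  rfl

lemma coe_lowerInt (n : ℤ) : (lowerInt n : Matrix (Fin 2) (Fin 2) ℤ) = !![1, 0; n, 1] :=
  rfl

lemma ofInt_upperInt (n : ℤ) : ofInt (upperInt n) = upper n :=
  GLPos_ext <| by
    rw [coe_ofInt, coe_upper]
    simp [coe_upperInt]

lemma ofInt_lowerInt (n : ℤ) : ofInt (lowerInt n) = lower n :=
  GLPos_ext <| by
    rw [coe_ofInt, coe_lower]
    simp [coe_lowerInt]

lemma upperInt_mem_Gamma0 (n : ℤ) : upperInt n ∈ Gamma0 N :=
  mem_Gamma0_iff_dvd.mpr (by simp [coe_upperInt])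

lemma lowerInt_mem_Gamma0 {n : ℤ} (h : (N : ℤ) ∣ n) : lowerInt n ∈ Gamma0 N :=
  mem_Gamma0_iff_dvd.mpr (by simpa [coe_lowerInt])

lemma toReal_scale_smul (d : ℕ) [NeZero d] (z : ℍ) :
    toReal (scale d) • z = ofComplex ((d : ℂ) * (z : ℂ)) := by
  have him : 0 < ((d : ℂ) * (z : ℂ)).im := by
    simpa using mul_pos (Nat.cast_pos.mpr (Nat.pos_of_neZero d)) z.im_pos
  apply UpperHalfPlane.ext
  rw [ofComplex_apply_of_im_pos him, coe_smul_of_det_pos (det_toReal_pos _)]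
  simp [num, denom, toReal, coe_scale]

lemma coe_slashOp_scale [NeZero N] (d : ℕ) [NeZero d] (φ : CuspSpace k N) :
    (slashOp k (scale d) (toBoundedForms φ) : ℍ → ℂ) = dilate d φ := by
  have hd : (0 : ℝ) < d := Nat.cast_pos.mpr (Nat.pos_of_neZero d)
  have hdet : (toReal (scale d)).det.val = d := by
    rw [det_toReal]
    simp [Matrix.det_fin_two, coe_scale]
  have hpow : (d : ℝ) ^ (1 - k / 2 : ℝ) * (d : ℝ) ^ ((k : ℤ) - 1) = (d : ℝ) ^ (k / 2 : ℝ) := by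
    rw [← Real.rpow_intCast, ← Real.rpow_add hd]
    push_cast
    ring_nf
  ext z
  have hdenom : denom (toReal (scale d)) z = 1 := by simp [denom, toReal, coe_scale]
  rw [coe_slashOp, unitarySlash, Pi.smul_apply, slash_apply_of_det_pos (det_toReal_pos _), hdenom,
    one_zpow, mul_one, hdet, toReal_scale_smul, coe_toBoundedForms, dilate, smul_eq_mul, ← hpow]
  push_cast
  ring

lemma slashOp_upper_toBoundedForms [NeZero N] (f : CuspSpace k N) (n : ℤ) :
    slashOp k (upper n) (toBoundedForms f) = toBoundedForms f := by
  rw [← ofInt_upperInt, slashOp_toBoundedForms f (upperInt_mem_Gamma0 n)]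

lemma slashOp_lower_toBoundedForms [NeZero N] (f : CuspSpace k N) {n : ℤ} (h : (N : ℤ) ∣ n) :
    slashOp k (lower n) (toBoundedForms f) = toBoundedForms f := by
  rw [← ofInt_lowerInt, slashOp_toBoundedForms f (lowerInt_mem_Gamma0 h)]

lemma slashOp_upper_scale [NeZero N] {d : ℕ} [NeZero d] (φ : CuspSpace k N) {x : ℚ} {n : ℤ}
    (h : d * x = n) : slashOp k (upper x) (slashOp k (scale d) (toBoundedForms φ)) =
      slashOp k (scale d) (toBoundedForms φ) := by
  rw [← slashOp_mul, scale_mul_upper, h, slashOp_mul, slashOp_upper_toBoundedForms]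

lemma slashOp_lower_scale [NeZero N] {d : ℕ} [NeZero d] (φ : CuspSpace k N) {n : ℤ}
    (h : (N : ℤ) ∣ n) : slashOp k (lower (d * n)) (slashOp k (scale d) (toBoundedForms φ)) =
      slashOp k (scale d) (toBoundedForms φ) := by
  rw [← slashOp_mul, scale_mul_lower, slashOp_mul, slashOp_lower_toBoundedForms φ h]

lemma ofInt_mul_scale_eq_iff {d : ℕ} [NeZero d] {x δ : SL(2, ℤ)} :
    ofInt x * scale d = scale d * ofInt δ ↔
      x 0 0 = δ 0 0 ∧ x 0 1 = d * δ 0 1 ∧ d * x 1 0 = δ 1 0 ∧ x 1 1 = δ 1 1 := by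
  rw [← Subtype.coe_inj, ← Units.val_inj, Subgroup.coe_mul, Subgroup.coe_mul, Units.val_mul,
    Units.val_mul, coe_ofInt, coe_ofInt, coe_scale, ← Matrix.ext_iff, Fin.forall_fin_two,
    Fin.forall_fin_two, Fin.forall_fin_two]
  simp only [Matrix.mul_apply, Fin.sum_univ_two, Matrix.of_apply, Matrix.cons_val_zero,
    Matrix.cons_val_one, Matrix.cons_val', mul_zero, zero_mul, add_zero, zero_add, mul_one, one_mul,
    mul_comm _ (d : ℚ), mul_right_inj' (Nat.cast_ne_zero.mpr (NeZero.ne d) : (d : ℚ) ≠ 0),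
    and_assoc]
  norm_cast

lemma exists_scale_conj_iff {d : ℕ} [NeZero d] (x : SL(2, ℤ)) :
    (∃ δ ∈ Gamma0 q, (scale d)⁻¹ * ofInt x = ofInt δ * (scale d)⁻¹) ↔
      (d : ℤ) ∣ x 0 1 ∧ (q : ℤ) ∣ d * x 1 0 := by
  simp only [eq_mul_inv_iff_mul_eq, mul_assoc, inv_mul_eq_iff_eq_mul, ofInt_mul_scale_eq_iff,
    mem_Gamma0_iff_dvd]
  constructor
  · rintro ⟨δ, hδ, -, h01, h10, -⟩
    exact ⟨⟨_, h01⟩, h10 ▸ hδ⟩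
  · rintro ⟨⟨t, ht⟩, hq⟩
    have hdet := x.det_coe
    rw [Matrix.det_fin_two, ht] at hdet
    let δ : SL(2, ℤ) := ⟨!![x 0 0, t; d * x 1 0, x 1 1], by
      rw [Matrix.det_fin_two_of]
      linear_combination hdet⟩
    exact ⟨δ, hq, rfl, ht, rfl, rfl⟩

lemma exists_toBoundedForms_eq_slashOp_scale [NeZero N] [NeZero q] {d : ℕ} [NeZero d]
    (h : d * N ∣ q) (φ : CuspSpace k N) :
    ∃ ψ : CuspSpace k q, toBoundedForms ψ = slashOp k (scale d) (toBoundedForms φ) := by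
  have hr (γ : Gamma0 q) : ∃! _i : Unit, ∃ δ ∈ Gamma0 N,
      scale d * ofInt (γ * (1 : Gamma0 q)⁻¹ : Gamma0 q) = ofInt δ * scale d := by
    obtain ⟨c, hc⟩ := (Int.natCast_dvd_natCast.mpr h).trans (mem_Gamma0_iff_dvd.mp γ.2)
    have hdet := γ.1.det_coe
    rw [Matrix.det_fin_two, hc] at hdet
    push_cast at hc hdet
    let δ : SL(2, ℤ) := ⟨!![γ.1 0 0, d * γ.1 0 1; N * c, γ.1 1 1], by
      rw [Matrix.det_fin_two_of]
      linear_combination hdet⟩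
    refine ⟨(), ⟨δ, mem_Gamma0_iff_dvd.mpr ⟨c, rfl⟩, ?_⟩, fun _ _ => rfl⟩
    rw [inv_one, mul_one, eq_comm, ofInt_mul_scale_eq_iff]
    exact ⟨rfl, rfl, hc ▸ (mul_assoc _ _ _).symm, rfl⟩
  obtain ⟨ψ, hψ⟩ := exists_toBoundedForms_eq_sum_slashOp φ (scale d) (fun _ => 1) hr
  exact ⟨ψ, by simpa using hψ⟩

lemma existsUnique_dvd_sub_mul {n : ℕ} [NeZero n] {a : ℤ} (ha : IsCoprime a n) (b : ℤ) :
    ∃! i : Fin n, (n : ℤ) ∣ b - i * a := by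
  have hinj : Function.Injective fun i : Fin n => ((i * a : ℤ) : ZMod n) := fun i j hij => by
    have hunit : IsUnit (a : ZMod n) := (ZMod.coe_int_isUnit_iff_isCoprime a n).mpr ha.symm
    simp only [Int.cast_mul, Int.cast_natCast] at hij
    have hmod := (ZMod.natCast_eq_natCast_iff _ _ n).mp (hunit.mul_right_cancel hij)
    exact Fin.ext (hmod.eq_of_lt_of_lt i.2 j.2)
  have hbij := (Fintype.bijective_iff_injective_and_card _).mpr ⟨hinj, by simp⟩
  have hiff (i : Fin n) : (n : ℤ) ∣ b - i * a ↔ ((i * a : ℤ) : ZMod n) = b := by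
    rw [← ZMod.intCast_zmod_eq_zero_iff_dvd, Int.cast_sub, sub_eq_zero, eq_comm]
  simpa only [hiff] using hbij.existsUnique (b : ZMod n)

lemma existsUnique_scale_conj {d e M : ℕ} [NeZero d] [NeZero e] [NeZero M] (hd : d ∣ M) (he : e ∣ M)
    {γ : SL(2, ℤ)} (hγ : γ ∈ Gamma0 M) : ∃! p : Fin d × Fin e, ∃ δ ∈ Gamma0 (d * e * M),
      (scale d)⁻¹ * ofInt (γ * (lowerInt (p.2 * M) * upperInt p.1)⁻¹) =
        ofInt δ * (scale d)⁻¹ := by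
  obtain ⟨c, hc⟩ := mem_Gamma0_iff_dvd.mp hγ
  have hentries (i j : ℤ) : (γ * (lowerInt (j * M) * upperInt i)⁻¹) 0 1 = γ 0 1 - i * γ 0 0 ∧
      (γ * (lowerInt (j * M) * upperInt i)⁻¹) 1 0 = γ 1 0 - j * M * (γ 1 1 - i * γ 1 0) := by
    simp [Matrix.mul_apply, Matrix.adjugate_fin_two, coe_upperInt, coe_lowerInt]
    constructor <;> ring
  have hiff (p : Fin d × Fin e) : (∃ δ ∈ Gamma0 (d * e * M),
      (scale d)⁻¹ * ofInt (γ * (lowerInt (p.2 * M) * upperInt p.1)⁻¹) = ofInt δ * (scale d)⁻¹) ↔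
      (d : ℤ) ∣ γ 0 1 - p.1 * γ 0 0 ∧ (e : ℤ) ∣ c - p.2 * (γ 1 1 - p.1 * γ 1 0) := by
    rw [exists_scale_conj_iff, (hentries _ _).1, (hentries _ _).2, hc,
      show (d : ℤ) * (M * c - p.2 * M * (γ 1 1 - p.1 * (M * c))) =
        d * M * (c - p.2 * (γ 1 1 - p.1 * (M * c))) by ring,
      show ((d * e * M : ℕ) : ℤ) = d * M * e by push_cast; ring,
      mul_dvd_mul_iff_left (by simp [NeZero.ne])]
  have hdet := γ.det_coe
  rw [Matrix.det_fin_two, hc] at hdet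
  obtain ⟨s, hs⟩ := hd
  obtain ⟨t, ht⟩ := he
  obtain ⟨i, hi, hi'⟩ := existsUnique_dvd_sub_mul (n := d) (a := γ 0 0)
    ⟨γ 1 1, -(γ 0 1 * s * c), by rw [hs] at hdet; push_cast at hdet; linear_combination hdet⟩ _
  obtain ⟨j, hj, hj'⟩ := existsUnique_dvd_sub_mul (n := e) (a := γ 1 1 - i * γ 1 0)
    ⟨γ 0 0, -((γ 0 1 - i * γ 0 0) * t * c), by
      rw [hc]; rw [ht] at hdet ⊢; push_cast at hdet ⊢; linear_combination hdet⟩ c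
  simp only [hiff]
  refine ⟨(i, j), ⟨hi, hj⟩, fun p hp => ?_⟩
  obtain rfl := hi' _ hp.1
  exact Prod.ext rfl (hj' _ hp.2)

end Dilation

section Averages

variable {k : ℤ}

/-- The average of the translates by `[1, i / d; 0, 1]` over `i` modulo `d`. -/
def upperMean (k : ℤ) (d : ℕ) : Module.End ℂ (boundedForms k) :=
  cyclicMean d fun s => slashOp k (upper s)

/-- The average of the translates by `[1, 0; q j / e, 1]` over `j` modulo `e`. -/
def lowerMean (k : ℤ) (q e : ℕ) : Module.End ℂ (boundedForms k) :=
  cyclicMean e fun t => slashOp k (lower (q * t))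

lemma upperMean_apply (d : ℕ) (f : boundedForms k) :
    upperMean k d f = cyclicMean d fun s => slashOp k (upper s) f := by
  simp only [upperMean, cyclicMean, LinearMap.smul_apply, LinearMap.sum_apply]

lemma lowerMean_apply (q e : ℕ) (f : boundedForms k) :
    lowerMean k q e f = cyclicMean e fun t => slashOp k (lower (q * t)) f := by
  simp only [lowerMean, cyclicMean, LinearMap.smul_apply, LinearMap.sum_apply]

lemma upper_zero : upper 0 = 1 :=
  GLPos_ext <| by simp [coe_upper, Matrix.one_fin_two]

lemma lower_zero : lower 0 = 1 :=
  GLPos_ext <| by simp [coe_lower, Matrix.one_fin_two]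

lemma slashOp_one (f : boundedForms k) : slashOp k 1 f = f :=
  Subtype.ext <| by simp [coe_slashOp, unitarySlash]

lemma upperMean_one : upperMean k 1 = 1 := by
  rw [upperMean, cyclicMean_one, upper_zero]
  exact LinearMap.ext slashOp_one

lemma lowerMean_one (q : ℕ) : lowerMean k q 1 = 1 := by
  rw [lowerMean, cyclicMean_one, mul_zero, lower_zero]
  exact LinearMap.ext slashOp_one

lemma pairing_slashOp_of_fixed {β : GL(2, ℚ)⁺} {g : boundedForms k} (hg : slashOp k β g = g)
    (f : boundedForms k) : pairing k g (slashOp k β f) = pairing k g f := by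
  rw [← pairing_slashOp β g f, hg]

lemma periodic_pairing_slashOp_upper {g : boundedForms k} {x : ℚ}
    (hg : slashOp k (upper x) g = g) (f : boundedForms k) :
    Function.Periodic (fun s => pairing k g (slashOp k (upper s) f)) x := fun s => by
  simp only [upper_add, slashOp_mul, pairing_slashOp_of_fixed hg]

lemma periodic_pairing_slashOp_lower {g : boundedForms k} {q : ℕ} {y : ℚ}
    (hg : slashOp k (lower (q * y)) g = g) (f : boundedForms k) :
    Function.Periodic (fun t => pairing k g (slashOp k (lower (q * t)) f)) y := fun t => by
  simp only [mul_add, lower_add, slashOp_mul, pairing_slashOp_of_fixed hg]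

lemma pairing_upperMean_mul {p d : ℕ} (hp : p ≠ 0) (hpd : p.Coprime d) {g : boundedForms k}
    (hg : slashOp k (upper (1 / p)) g = g) (f : boundedForms k) :
    pairing k g (upperMean k (p * d) f) = pairing k g (upperMean k d f) := by
  simp only [upperMean_apply, map_cyclicMean]
  exact cyclicMean_mul_of_periodic hp hpd (periodic_pairing_slashOp_upper hg f)

lemma pairing_lowerMean_mul {q p e : ℕ} (hp : p ≠ 0) (hpe : p.Coprime e) {g : boundedForms k}
    (hg : slashOp k (lower (q * (1 / p))) g = g) (f : boundedForms k) :
    pairing k g (lowerMean k q (p * e) f) = pairing k g (lowerMean k q e f) := by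
  simp only [lowerMean_apply, map_cyclicMean]
  exact cyclicMean_mul_of_periodic hp hpe (periodic_pairing_slashOp_lower hg f)

lemma pairing_upperMean_of_fixed {d : ℕ} (hd : d ≠ 0) {g : boundedForms k}
    (hg : slashOp k (upper (1 / d)) g = g) (f : boundedForms k) :
    pairing k g (upperMean k d f) = pairing k g f := by
  simpa [upperMean_one] using pairing_upperMean_mul hd d.coprime_one_right hg f

lemma pairing_lowerMean_of_fixed {q e : ℕ} (he : e ≠ 0) {g : boundedForms k}
    (hg : slashOp k (lower (q * (1 / e))) g = g) (f : boundedForms k) :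
    pairing k g (lowerMean k q e f) = pairing k g f := by
  simpa [lowerMean_one] using pairing_lowerMean_mul he e.coprime_one_right hg f

lemma upperMean_lowerMean_apply (q d e : ℕ) (f : boundedForms k) :
    upperMean k d (lowerMean k q e f) = ((d : ℂ)⁻¹ * (e : ℂ)⁻¹) •
      ∑ p : Fin d × Fin e, slashOp k (lower (q * (p.2 / e)) * upper (p.1 / d)) f := by
  rw [upperMean_apply]
  simp only [lowerMean_apply, map_cyclicMean, ← slashOp_mul]
  simp only [cyclicMean, ← Finset.smul_sum, smul_smul, Finset.sum_range, Fintype.sum_prod_type]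

lemma lowerMean_upperMean_apply (q d e : ℕ) (f : boundedForms k) :
    lowerMean k q e (upperMean k d f) = ((d : ℂ)⁻¹ * (e : ℂ)⁻¹) •
      ∑ p : Fin d × Fin e, slashOp k (upper (p.1 / d) * lower (q * (p.2 / e))) f := by
  rw [lowerMean_apply]
  simp only [upperMean_apply, map_cyclicMean, ← slashOp_mul]
  simp only [cyclicMean, ← Finset.smul_sum, smul_smul, Finset.sum_range,
    Fintype.sum_prod_type_right, mul_comm]

end Averages

section LevelLowering

variable {k d e M : ℕ} [NeZero d] [NeZero e] [NeZero M]

lemma exists_slashOp_scale_eq_upperMean_lowerMean (hd : d ∣ M) (he : e ∣ M)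
    (f : CuspSpace k (d * e * M)) : ∃ ψ : CuspSpace k M, slashOp k (scale d) (toBoundedForms ψ) =
      upperMean k d (lowerMean k (d * e * M) e (toBoundedForms f)) := by
  let r (p : Fin d × Fin e) : Gamma0 M := ⟨lowerInt (p.2 * M) * upperInt p.1,
    mul_mem (lowerInt_mem_Gamma0 (dvd_mul_left _ _)) (upperInt_mem_Gamma0 _)⟩
  obtain ⟨ψ, hψ⟩ := exists_toBoundedForms_eq_sum_slashOp f (scale d)⁻¹ r fun γ =>
    existsUnique_scale_conj hd he γ.2
  have hmul (p : Fin d × Fin e) : (scale d)⁻¹ * ofInt (r p) * scale d =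
      lower ((d * e * M : ℕ) * (p.2 / e)) * upper (p.1 / d) := by
    have hd0 : (d : ℚ) ≠ 0 := Nat.cast_ne_zero.mpr (NeZero.ne d)
    have he0 : (e : ℚ) ≠ 0 := Nat.cast_ne_zero.mpr (NeZero.ne e)
    have hu : scale d * upper (p.1 / d) = upper p.1 * scale d := by
      rw [scale_mul_upper, mul_div_cancel₀ _ hd0]
    have hl : scale d * lower ((d * e * M : ℕ) * (p.2 / e)) = lower (p.2 * M) * scale d := by
      rw [← scale_mul_lower]
      congr 2
      push_cast
      field_simp
    rw [mul_assoc, inv_mul_eq_iff_eq_mul, ← mul_assoc, hl, mul_assoc, hu, ← mul_assoc, map_mul,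
      ofInt_lowerInt, ofInt_upperInt]
    norm_cast
  refine ⟨((d : ℂ)⁻¹ * (e : ℂ)⁻¹) • ψ, ?_⟩
  rw [map_smul, map_smul, hψ, map_sum, upperMean_lowerMean_apply]
  exact congrArg _ (Finset.sum_congr rfl fun p _ => by rw [← slashOp_mul, hmul])

lemma slashOp_upper_mul_lower (hd : d ∣ M) (he : e ∣ M) (f : CuspSpace k (d * e * M)) (i j : ℤ) :
    slashOp k (upper (i / d) * lower (d * M * j)) (toBoundedForms f) =
      slashOp k (lower (d * M * j) * upper (i / d)) (toBoundedForms f) := by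
  obtain ⟨s, rfl⟩ := hd
  obtain ⟨t, ht⟩ := he
  have hd0 : (d : ℚ) ≠ 0 := Nat.cast_ne_zero.mpr (NeZero.ne d)
  set w : ℤ := i * j * (d * s) with hw
  let δ : SL(2, ℤ) := ⟨!![1 + w + w ^ 2, -(i ^ 2 * j * s); d * (d * s) * j * w, 1 - w], by
    rw [Matrix.det_fin_two_of, hw]
    ring⟩
  have hδ : δ ∈ Gamma0 (d * e * (d * s)) := by
    refine mem_Gamma0_iff_dvd.mpr ⟨i * j ^ 2 * t, ?_⟩
    have hew : w = e * (i * j * t) := by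
      rw [hw, mul_left_comm (e : ℤ)]
      exact_mod_cast congrArg (fun n : ℕ => i * j * (n : ℤ)) ht
    simp only [δ, Matrix.of_apply, Matrix.cons_val, hew]
    push_cast
    ring
  have hcomm : upper (i / d) * lower (d * (d * s : ℕ) * j) =
      ofInt δ * (lower (d * (d * s : ℕ) * j) * upper (i / d)) := by
    apply GLPos_ext
    simp only [Subgroup.coe_mul, Units.val_mul, coe_upper, coe_lower, coe_ofInt]
    ext a b
    fin_cases a <;> fin_cases b <;> simp [δ, hw] <;> field_simp <;> ring
  rw [hcomm, slashOp_mul, slashOp_toBoundedForms f hδ]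

lemma upperMean_lowerMean_comm (hd : d ∣ M) (he : e ∣ M) (f : CuspSpace k (d * e * M)) :
    upperMean k d (lowerMean k (d * e * M) e (toBoundedForms f)) =
      lowerMean k (d * e * M) e (upperMean k d (toBoundedForms f)) := by
  have he0 : (e : ℚ) ≠ 0 := Nat.cast_ne_zero.mpr (NeZero.ne e)
  rw [upperMean_lowerMean_apply, lowerMean_upperMean_apply]
  refine congrArg _ (Finset.sum_congr rfl fun p _ => ?_)
  have hlower : ((d * e * M : ℕ) : ℚ) * (p.2 / e) = d * M * (p.2 : ℤ) := by
    push_cast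
    field_simp
  rw [hlower]
  exact (slashOp_upper_mul_lower hd he f p.1 p.2).symm

end LevelLowering

section FourierCoefficients

variable {k N : ℕ}

lemma qParam_ofComplex_mul (d : ℕ) [NeZero d] (z : ℍ) :
    Function.Periodic.qParam 1 (ofComplex ((d : ℂ) * (z : ℂ)) : ℍ) =
      Function.Periodic.qParam 1 (z : ℂ) ^ d := by
  have him : 0 < ((d : ℂ) * (z : ℂ)).im := by
    simpa using mul_pos (Nat.cast_pos.mpr (Nat.pos_of_neZero d)) z.im_pos
  rw [ofComplex_apply_of_im_pos him, Function.Periodic.qParam, Function.Periodic.qParam,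
    ← Complex.exp_nat_mul]
  congr 1
  push_cast
  ring

lemma qExpansion_coeff_dilate {q d : ℕ} [NeZero N] [NeZero q] [NeZero d] {φ : CuspSpace k N}
    {ψ : CuspSpace k q} (h : (ψ : ℍ → ℂ) = dilate d φ) (m : ℕ) :
    (qExpansion 1 ψ).coeff m = if d ∣ m then
      (((d : ℝ) ^ ((k : ℝ) / 2) : ℝ) : ℂ) * (qExpansion 1 φ).coeff (m / d) else 0 := by
  refine (ModularFormClass.qExpansion_coeff_unique (f := ψ) (c := fun m => if d ∣ m then
      (((d : ℝ) ^ ((k : ℝ) / 2) : ℝ) : ℂ) * (qExpansion 1 φ).coeff (m / d) else 0)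
    one_pos (by simp) (fun z => ?_) m).symm
  have hsum := ModularForm.hasSum_qExpansion (f := φ) one_pos (by simp)
    (ofComplex ((d : ℂ) * (z : ℂ)))
  rw [congrFun h z, dilate, ← (mul_right_injective₀ (NeZero.ne d)).hasSum_iff]
  · refine (hsum.mul_left (((d : ℝ) ^ ((k : ℝ) / 2) : ℝ) : ℂ)).congr_fun fun m => ?_
    simp only [Function.comp_apply, dvd_mul_right, if_true,
      Nat.mul_div_cancel_left _ (Nat.pos_of_neZero d), smul_eq_mul, qParam_ofComplex_mul]
    ring
  · intro m hm
    rw [if_neg fun ⟨t, ht⟩ => hm ⟨t, ht.symm⟩, zero_smul]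

lemma rho_dilate {q d : ℕ} [NeZero N] [NeZero q] [NeZero d] {φ : CuspSpace k N}
    {ψ : CuspSpace k q} (h : toBoundedForms ψ = slashOp k (scale d) (toBoundedForms φ)) (m : ℕ) :
    rho m ψ = if d ∣ m then rho (m / d) φ else 0 := by
  have hcoe : (ψ : ℍ → ℂ) = dilate d φ := by rw [← coe_slashOp_scale, ← h, coe_toBoundedForms]
  rw [rho, qExpansion_coeff_dilate hcoe]
  split_ifs with hdm
  · obtain ⟨t, rfl⟩ := hdm
    have hd : (0 : ℝ) < d := Nat.cast_pos.mpr (Nat.pos_of_neZero d)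
    rw [rho, Nat.mul_div_cancel_left _ (Nat.pos_of_neZero d), Nat.cast_mul,
      Real.mul_rpow hd.le t.cast_nonneg, Complex.ofReal_mul, mul_div_mul_left]
    exact Complex.ofReal_ne_zero.mpr (Real.rpow_pos_of_pos hd _).ne'
  · rw [zero_div]

/-- The normalized Fourier coefficient `ρ(m; ·)` as a linear functional on `𝒜(N)`. -/
def rhoHom (m : ℕ) : CuspSpace k N →ₗ[ℂ] ℂ where
  toFun := rho m
  map_add' f g := by
    rw [rho, FunLike.coe_add, ModularForm.qExpansion_add one_pos (by simp), map_add, add_div]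
    rfl
  map_smul' c f := by
    rw [rho, FunLike.coe_smul, ModularForm.qExpansion_smul one_pos (by simp),
      PowerSeries.coeff_smul, smul_eq_mul, mul_div_assoc]
    rfl

lemma rho_sum_smul (m : ℕ) (B : Finset (CuspSpace k N)) (c : CuspSpace k N → ℂ) :
    rho m (∑ φ ∈ B, c φ • φ) = ∑ φ ∈ B, c φ * rho m φ :=
  (map_sum (rhoHom m) _ B).trans <| Finset.sum_congr rfl fun φ _ => map_smul (rhoHom m) (c φ) φ

end FourierCoefficients

section OrthonormalBases

variable {k N : ℕ} [NeZero N] {V : ℝ}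

lemma conj_inner (f g : CuspSpace k N) : conj (inner V f g) = inner V g f := by
  rw [inner_eq_pairing, inner_eq_pairing, map_mul, Complex.conj_ofReal, conj_pairing]

lemma inner_sum_smul (f : CuspSpace k N) (B : Finset (CuspSpace k N)) (c : CuspSpace k N → ℂ) :
    inner V f (∑ φ ∈ B, c φ • φ) = ∑ φ ∈ B, c φ * inner V f φ := by
  simp only [inner_eq_pairing, map_sum, map_smul, smul_eq_mul, Finset.mul_sum, mul_left_comm]

variable {S : Set (CuspSpace k N)} {B : Finset (CuspSpace k N)}

lemma IsOrthonormalBasis.eq_sum_inner_smul (hB : IsOrthonormalBasis V S B) {f : CuspSpace k N}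
    (hf : f ∈ S) : f = ∑ φ ∈ B, inner V φ f • φ := by
  obtain ⟨c, -, rfl⟩ := Submodule.mem_span_finset.mp (hB.spanning hf)
  refine Finset.sum_congr rfl fun φ hφ => ?_
  rw [inner_sum_smul, Finset.sum_eq_single_of_mem φ hφ fun ψ hψ hne => by
    rw [hB.orthogonal φ hφ ψ hψ hne.symm, mul_zero], hB.norm_eq_one φ hφ, mul_one]

lemma IsOrthonormalBasis.rho_eq_sum (hB : IsOrthonormalBasis V S B) {f : CuspSpace k N}
    (hf : f ∈ S) (m : ℕ) : rho m f = ∑ φ ∈ B, inner V φ f * rho m φ := by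
  conv_lhs => rw [hB.eq_sum_inner_smul hf]
  exact rho_sum_smul m B _

lemma IsOrthonormalBasis.exists_inner_eq_conj_rho (hB : IsOrthonormalBasis V Set.univ B) (n : ℕ) :
    ∃ R : CuspSpace k N, ∀ φ, inner V φ R = conj (rho n φ) := by
  refine ⟨∑ ψ ∈ B, conj (rho n ψ) • ψ, fun φ => ?_⟩
  rw [inner_sum_smul, hB.rho_eq_sum (Set.mem_univ φ), map_sum]
  exact Finset.sum_congr rfl fun ψ _ => by rw [map_mul, conj_inner, mul_comm]

lemma IsOrthonormalBasis.coeffSum_eq_rho (hB : IsOrthonormalBasis V S B) {n : ℕ}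
    {P : CuspSpace k N} (hP : P ∈ S) (h : ∀ φ ∈ S, inner V φ P = conj (rho n φ)) (m : ℕ) :
    coeffSum B m n = rho m P := by
  rw [coeffSum, hB.rho_eq_sum hP]
  exact Finset.sum_congr rfl fun φ hφ => by rw [h φ (hB.subset hφ), mul_comm]

end OrthonormalBases

section Arithmetic

open ArithmeticFunction (moebius)

variable {A : Type*} [AddCommGroup A]

lemma sum_divisors_moebius_smul_eq_zero {q p : ℕ} (hq : q ≠ 0) (hp : p.Prime) (hpq : p ∣ q)
    {a : ℕ → A} (ha : ∀ d, p.Coprime d → a (p * d) = a d) :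
    ∑ d ∈ q.divisors, moebius d • a d = 0 := by
  obtain ⟨n, r, hpr, rfl⟩ := Nat.exists_eq_pow_mul_and_not_dvd hq p hp.ne_one
  have hcop : p.Coprime r := hp.coprime_iff_not_dvd.mpr hpr
  obtain ⟨b, rfl⟩ : ∃ b, n = b + 1 := Nat.exists_eq_succ_of_ne_zero fun hn => hpr <| by
    simpa [hn] using hpq
  have hsquare (i e : ℕ) : moebius (p ^ (i + 1 + 1) * e) = 0 := by
    refine ArithmeticFunction.moebius_eq_zero_of_not_squarefree fun h => ?_
    exact hp.not_isUnit (h p ⟨p ^ i * e, by ring⟩)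
  have hprime (e : ℕ) (he : e ∈ r.divisors) : moebius (p * e) • a (p * e) = -(moebius e • a e) := by
    have hpe := hcop.coprime_dvd_right (Nat.dvd_of_mem_divisors he)
    rw [ArithmeticFunction.isMultiplicative_moebius.map_mul_of_coprime hpe,
      ArithmeticFunction.moebius_apply_prime hp, neg_one_mul, neg_zsmul, ha e hpe]
  rw [Nat.divisors_mul, Finset.mul_def, Finset.sum_image (hcop.pow_left _).mul_injOn_divisors,
    Finset.sum_product, Nat.sum_divisors_prime_pow hp, Finset.sum_range_succ',
    Finset.sum_range_succ']
  simp only [hsquare, zero_smul, Finset.sum_const_zero, zero_add, pow_zero, one_mul, pow_one]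
  rw [Finset.sum_congr rfl hprime, Finset.sum_neg_distrib, neg_add_cancel]

lemma sum_moebius_mul_smul_congr {q : ℕ} {s : Finset ℕ} {a b : ℕ → ℕ → A}
    (h : ∀ d ∈ s, ∀ e ∈ q.divisors, Squarefree d → Squarefree e → a d e = b d e) :
    ∑ d ∈ s, ∑ e ∈ q.divisors, (moebius d * moebius e) • a d e =
      ∑ d ∈ s, ∑ e ∈ q.divisors, (moebius d * moebius e) • b d e := by
  refine Finset.sum_congr rfl fun d hd => Finset.sum_congr rfl fun e he => ?_
  by_cases hde : moebius d * moebius e = 0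
  · rw [hde, zero_smul, zero_smul]
  · obtain ⟨hd', he'⟩ := mul_ne_zero_iff.mp hde
    rw [h d hd e he (ArithmeticFunction.moebius_ne_zero_iff_squarefree.mp hd')
      (ArithmeticFunction.moebius_ne_zero_iff_squarefree.mp he')]

lemma radical_pow_dvd_of_forall_prime {q n : ℕ} (h : ∀ p : ℕ, p.Prime → p ∣ q → p ^ n ∣ q) :
    UniqueFactorizationMonoid.radical q ^ n ∣ q := by
  rw [Nat.radical_eq_prod_primeFactors, ← Finset.prod_pow]
  refine Finset.prod_dvd_of_isRelPrime (fun p hp r hr hpr => ?_) fun p hp =>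
    h p (Nat.prime_of_mem_primeFactors hp) (Nat.dvd_of_mem_primeFactors hp)
  exact Nat.coprime_iff_isRelPrime.mp <| .pow _ _ <|
    (Nat.coprime_primes (Nat.prime_of_mem_primeFactors hp) (Nat.prime_of_mem_primeFactors hr)).mpr
      hpr

lemma exists_eq_mul_of_squarefree {q : ℕ} (hq : q ≠ 0)
    (hcube : ∀ p : ℕ, p.Prime → p ∣ q → p ^ 3 ∣ q) {d e : ℕ} (hd : Squarefree d)
    (he : Squarefree e) (hdq : d ∣ q) (heq : e ∣ q) : ∃ M, q = d * e * M ∧ d ∣ M ∧ e ∣ M := by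
  set r := UniqueFactorizationMonoid.radical q
  obtain ⟨s, hs⟩ := radical_pow_dvd_of_forall_prime hcube
  obtain ⟨d', hd'⟩ : d ∣ r :=
    (UniqueFactorizationMonoid.dvd_radical_iff hd.isRadical hq).mpr hdq
  obtain ⟨e', he'⟩ : e ∣ r :=
    (UniqueFactorizationMonoid.dvd_radical_iff he.isRadical hq).mpr heq
  refine ⟨d' * e' * r * s, ?_, ⟨d' * d' * e' * s, ?_⟩, ⟨e' * d' * e' * s, ?_⟩⟩
  · calc q = r * r * r * s := by rw [hs]; ring
      _ = (d * d') * (e * e') * r * s := by rw [← hd', ← he']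
      _ = _ := by ring
  · rw [hd']
    ring
  · rw [he']
    ring

end Arithmetic

section Newspace

open ArithmeticFunction (moebius)

/-- On cusp forms of level `q`, with `q` divisible by the cube of each of its prime factors, this
is the projection to the newspace. -/
def newProjection (k : ℤ) (q : ℕ) : Module.End ℂ (boundedForms k) :=
  ∑ d ∈ q.divisors, ∑ e ∈ q.divisors, (moebius d * moebius e) • (upperMean k d * lowerMean k q e)

lemma newProjection_apply {k : ℤ} (q : ℕ) (f : boundedForms k) :
    newProjection k q f = ∑ d ∈ q.divisors, ∑ e ∈ q.divisors,
      (moebius d * moebius e) • upperMean k d (lowerMean k q e f) := by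
  simp only [newProjection, LinearMap.sum_apply, LinearMap.smul_apply, Module.End.mul_apply]

lemma pairing_newProjection {k : ℤ} (q : ℕ) (g f : boundedForms k) :
    pairing k g (newProjection k q f) = ∑ d ∈ q.divisors, ∑ e ∈ q.divisors,
      (moebius d * moebius e) • pairing k g (upperMean k d (lowerMean k q e f)) := by
  simp only [newProjection_apply, map_sum, map_zsmul]

lemma pairing_newProjection_of_fixed_upper {k : ℤ} {q p : ℕ} (hq : q ≠ 0) (hp : p.Prime)
    (hpq : p ∣ q) {g : boundedForms k} (hg : slashOp k (upper (1 / p)) g = g)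
    (f : boundedForms k) : pairing k g (newProjection k q f) = 0 := by
  rw [pairing_newProjection, Finset.sum_comm]
  refine Finset.sum_eq_zero fun e _ => ?_
  simp only [mul_comm (moebius _) (moebius e), mul_smul, ← Finset.smul_sum]
  rw [sum_divisors_moebius_smul_eq_zero hq hp hpq fun d hpd =>
    pairing_upperMean_mul hp.ne_zero hpd hg _, smul_zero]

variable {k q : ℕ} [NeZero q]

lemma pairing_newProjection_of_fixed_lower (hcube : ∀ p : ℕ, p.Prime → p ∣ q → p ^ 3 ∣ q)
    {p : ℕ} (hp : p.Prime) (hpq : p ∣ q) {g : boundedForms k}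
    (hg : slashOp k (lower (q * (1 / p))) g = g) (f : CuspSpace k q) :
    pairing k g (newProjection k q (toBoundedForms f)) = 0 := by
  have hcomm : ∀ d ∈ q.divisors, ∀ e ∈ q.divisors, Squarefree d → Squarefree e →
      pairing k g (upperMean k d (lowerMean k q e (toBoundedForms f))) =
        pairing k g (lowerMean k q e (upperMean k d (toBoundedForms f))) := by
    intro d hd e he hd' he'
    obtain ⟨M, rfl, hdM, heM⟩ := exists_eq_mul_of_squarefree (NeZero.ne q) hcube hd' he'
      (Nat.dvd_of_mem_divisors hd) (Nat.dvd_of_mem_divisors he)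
    have : NeZero M := ⟨right_ne_zero_of_mul (NeZero.ne (d * e * M))⟩
    have : NeZero d := ⟨hd'.ne_zero⟩
    have : NeZero e := ⟨he'.ne_zero⟩
    rw [upperMean_lowerMean_comm hdM heM]
  rw [pairing_newProjection, sum_moebius_mul_smul_congr hcomm]
  refine Finset.sum_eq_zero fun d _ => ?_
  simp only [mul_smul, ← Finset.smul_sum]
  rw [sum_divisors_moebius_smul_eq_zero (NeZero.ne q) hp hpq fun e hpe =>
    pairing_lowerMean_mul hp.ne_zero hpe hg _, smul_zero]

lemma exists_prime_fixed_of_dilate {g : CuspSpace k q} {ℓ d : ℕ} (hℓ : ℓ ∣ q) (hne : ℓ ≠ q)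
    (hd : d ∣ q / ℓ) {φ : CuspSpace k ℓ} (hg : (g : ℍ → ℂ) = dilate d φ) :
    ∃ p : ℕ, p.Prime ∧ p ∣ q ∧ (slashOp k (upper (1 / p)) (toBoundedForms g) = toBoundedForms g ∨
      slashOp k (lower (q * (1 / p))) (toBoundedForms g) = toBoundedForms g) := by
  obtain ⟨s, hs⟩ := hd
  have hq : q = ℓ * (d * s) := by rw [← hs, Nat.mul_div_cancel' hℓ]
  have : NeZero ℓ := ⟨left_ne_zero_of_mul (hq ▸ NeZero.ne q)⟩
  have : NeZero d := ⟨left_ne_zero_of_mul (right_ne_zero_of_mul (hq ▸ NeZero.ne q))⟩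
  have hg' : toBoundedForms g = slashOp k (scale d) (toBoundedForms φ) :=
    Subtype.ext <| by rw [coe_slashOp_scale, ← hg, coe_toBoundedForms]
  obtain ⟨p, hp, hpds⟩ := Nat.exists_prime_and_dvd fun h : d * s = 1 => hne (by simp [hq, h])
  have hp0 : (p : ℚ) ≠ 0 := Nat.cast_ne_zero.mpr hp.ne_zero
  refine ⟨p, hp, hq ▸ dvd_mul_of_dvd_right hpds ℓ, ?_⟩
  rw [hg']
  rcases hp.dvd_mul.mp hpds with ⟨u, hu⟩ | ⟨u, hu⟩
  · refine .inl (slashOp_upper_scale φ (n := u) ?_)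
    rw [hu]
    push_cast
    field_simp
  · have hlower : (q * (1 / p) : ℚ) = d * (ℓ * u : ℤ) := by
      rw [hq, hu]
      push_cast
      field_simp
    rw [hlower]
    exact .inr (slashOp_lower_scale φ (dvd_mul_right _ _))

lemma pairing_newProjection_of_mem_oldspace (hcube : ∀ p : ℕ, p.Prime → p ∣ q → p ^ 3 ∣ q)
    {g : CuspSpace k q} (hg : g ∈ oldspace k q) (f : CuspSpace k q) :
    pairing k (toBoundedForms g) (newProjection k q (toBoundedForms f)) = 0 := by
  induction hg using Submodule.span_induction with
  | mem g hg =>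
    obtain ⟨ℓ, d, hℓ, hne, hd, φ, hgφ⟩ := hg
    obtain ⟨p, hp, hpq, hupper | hlower⟩ := exists_prime_fixed_of_dilate hℓ hne hd hgφ
    · exact pairing_newProjection_of_fixed_upper (NeZero.ne q) hp hpq hupper _
    · exact pairing_newProjection_of_fixed_lower hcube hp hpq hlower f
  | zero => rw [map_zero, map_zero, LinearMap.zero_apply]
  | add g h _ _ hg hh => rw [map_add, map_add, LinearMap.add_apply, hg, hh, add_zero]
  | smul c g _ hg => rw [map_smul, map_smulₛₗ, LinearMap.smul_apply, hg, smul_zero]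

lemma upperMean_lowerMean_mem_map_oldspace {d e M : ℕ} [NeZero d] [NeZero e] [NeZero M]
    (hd : d ∣ M) (he : e ∣ M) (hde : d * e ≠ 1) (f : CuspSpace k (d * e * M)) :
    upperMean k d (lowerMean k (d * e * M) e (toBoundedForms f)) ∈
      (oldspace k (d * e * M)).map toBoundedForms := by
  obtain ⟨ψ, hψ⟩ := exists_slashOp_scale_eq_upperMean_lowerMean hd he f
  obtain ⟨s, hs⟩ := exists_toBoundedForms_eq_slashOp_scale (q := d * e * M)
    ⟨e, mul_right_comm d e M⟩ ψ
  have hM : M ≠ d * e * M := fun h => hde <|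
    Nat.eq_of_mul_eq_mul_right (Nat.pos_of_neZero M) (by rw [one_mul, ← h])
  refine ⟨s, Submodule.subset_span ⟨M, d, dvd_mul_left _ _, hM, ?_, ψ, ?_⟩, hs.trans hψ⟩
  · rw [Nat.mul_div_cancel _ (Nat.pos_of_neZero M)]
    exact dvd_mul_right d e
  · rw [← coe_slashOp_scale, ← hs, coe_toBoundedForms]

lemma newProjection_sub_mem_oldspace (hcube : ∀ p : ℕ, p.Prime → p ∣ q → p ^ 3 ∣ q)
    (f : CuspSpace k q) :
    newProjection k q (toBoundedForms f) - toBoundedForms f ∈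
      (oldspace k q).map toBoundedForms := by
  have hterm (d : ℕ) (hd : d ∈ q.divisors) (e : ℕ) (he : e ∈ q.divisors) (hne : (d, e) ≠ (1, 1)) :
      (moebius d * moebius e) • upperMean k d (lowerMean k q e (toBoundedForms f)) ∈
        (oldspace k q).map toBoundedForms := by
    by_cases hde : moebius d * moebius e = 0
    · rw [hde, zero_smul]
      exact zero_mem _
    simp only [mul_eq_zero, not_or, ArithmeticFunction.moebius_ne_zero_iff_squarefree] at hde
    obtain ⟨M, rfl, hdM, heM⟩ := exists_eq_mul_of_squarefree (NeZero.ne q) hcube hde.1 hde.2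
      (Nat.dvd_of_mem_divisors hd) (Nat.dvd_of_mem_divisors he)
    have : NeZero M := ⟨right_ne_zero_of_mul (NeZero.ne (d * e * M))⟩
    have : NeZero d := ⟨hde.1.ne_zero⟩
    have : NeZero e := ⟨hde.2.ne_zero⟩
    exact zsmul_mem (upperMean_lowerMean_mem_map_oldspace hdM heM (by simpa using hne) f) _
  have hone : ((1, 1) : ℕ × ℕ) ∈ q.divisors ×ˢ q.divisors := by simp [NeZero.ne q]
  rw [newProjection_apply, ← Finset.sum_product', ← Finset.add_sum_erase _ _ hone]
  simp only [ArithmeticFunction.moebius_apply_one, mul_one, one_smul, upperMean_one, lowerMean_one,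
    Module.End.one_apply, add_sub_cancel_left]
  refine Submodule.sum_mem _ fun x hx => ?_
  obtain ⟨hne, hx⟩ := Finset.mem_erase.mp hx
  exact hterm x.1 (Finset.mem_product.mp hx).1 x.2 (Finset.mem_product.mp hx).2 hne

lemma exists_mem_newspace_sub_mem_oldspace (V : ℝ)
    (hcube : ∀ p : ℕ, p.Prime → p ∣ q → p ^ 3 ∣ q) (f : CuspSpace k q) :
    ∃ P ∈ newspace V k q, P - f ∈ oldspace k q ∧
      toBoundedForms P = newProjection k q (toBoundedForms f) := by
  obtain ⟨g, hg, hgf⟩ := newProjection_sub_mem_oldspace hcube f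
  have hP : toBoundedForms (g + f) = newProjection k q (toBoundedForms f) := by
    rw [map_add, hgf, sub_add_cancel]
  refine ⟨g + f, fun h hh => ?_, by rwa [add_sub_cancel_right], hP⟩
  rw [inner_eq_pairing, hP, pairing_newProjection_of_mem_oldspace hcube hh, mul_zero]

lemma inner_eq_of_sub_mem_oldspace {V : ℝ} {φ f P : CuspSpace k q} (hφ : φ ∈ newspace V k q)
    (hP : P - f ∈ oldspace k q) : inner V φ P = inner V φ f := by
  have horth : inner V φ (P - f) = 0 := by rw [← conj_inner, hφ _ hP, map_zero]
  rwa [inner_eq_pairing, map_sub, map_sub, mul_sub, ← inner_eq_pairing, ← inner_eq_pairing,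
    sub_eq_zero] at horth

end Newspace

section MainFormula

open ArithmeticFunction (moebius)

variable {k : ℕ} {V : ℝ}

lemma pairing_slashOp_scale_upperMean_lowerMean {d e M : ℕ} [NeZero d] [NeZero e] [NeZero M]
    (φ : CuspSpace k M) (f : boundedForms k) :
    pairing k (slashOp k (scale d) (toBoundedForms φ))
        (upperMean k d (lowerMean k (d * e * M) e f)) =
      pairing k (slashOp k (scale d) (toBoundedForms φ)) f := by
  have hd : (d : ℚ) ≠ 0 := Nat.cast_ne_zero.mpr (NeZero.ne d)
  have he : (e : ℚ) ≠ 0 := Nat.cast_ne_zero.mpr (NeZero.ne e)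
  have hlower : ((d * e * M : ℕ) : ℚ) * (1 / e) = d * (M : ℤ) := by
    push_cast
    field_simp
  rw [pairing_upperMean_of_fixed (NeZero.ne d) (slashOp_upper_scale φ (n := 1) (by simp [hd])),
    pairing_lowerMean_of_fixed (NeZero.ne e) (hlower ▸ slashOp_lower_scale φ dvd_rfl)]

lemma mul_pairing_upperMean_lowerMean {d e M : ℕ} [NeZero d] [NeZero e] [NeZero M]
    (hd : d ∣ M) (he : e ∣ M) {B : Finset (CuspSpace k M)} (hB : IsOrthonormalBasis V Set.univ B)
    {m n : ℕ} {Rm Rn : CuspSpace k (d * e * M)} (hRm : ∀ φ, inner V φ Rm = conj (rho m φ))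
    (hRn : ∀ φ, inner V φ Rn = conj (rho n φ)) :
    V * pairing k (toBoundedForms Rm)
        (upperMean k d (lowerMean k (d * e * M) e (toBoundedForms Rn))) =
      if d ∣ m ∧ d ∣ n then coeffSum B (m / d) (n / d) else 0 := by
  have hdM : d * M ∣ d * e * M := ⟨e, mul_right_comm d e M⟩
  obtain ⟨ψ, hψ⟩ := exists_slashOp_scale_eq_upperMean_lowerMean hd he Rn
  obtain ⟨ψ', hψ'⟩ := exists_toBoundedForms_eq_slashOp_scale hdM ψ
  have hinner (φ : CuspSpace k M) :
      inner V φ ψ = if d ∣ n then conj (rho (n / d) φ) else 0 := by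
    obtain ⟨φ', hφ'⟩ := exists_toBoundedForms_eq_slashOp_scale hdM φ
    rw [inner_eq_pairing, ← pairing_slashOp (scale d), hψ,
      pairing_slashOp_scale_upperMean_lowerMean, ← hφ', ← inner_eq_pairing, hRn, rho_dilate hφ',
      apply_ite conj, map_zero]
  rw [← hψ, ← hψ', ← inner_eq_pairing, ← conj_inner, hRm, Complex.conj_conj, rho_dilate hψ',
    hB.rho_eq_sum (Set.mem_univ ψ), ite_and]
  refine if_congr Iff.rfl ?_ rfl
  split_ifs with hn
  · exact Finset.sum_congr rfl fun φ _ => by rw [hinner, if_pos hn, mul_comm]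
  · exact Finset.sum_eq_zero fun φ _ => by rw [hinner, if_neg hn, zero_mul]

lemma sum_divisors_gcd {A : Type*} [AddCommMonoid A] {q : ℕ} (hq : q ≠ 0) (m n : ℕ) (a : ℕ → A) :
    ∑ d ∈ ((m.gcd n).gcd q).divisors, a d =
      ∑ d ∈ q.divisors, if d ∣ m ∧ d ∣ n then a d else 0 := by
  rw [← Finset.sum_filter]
  congr 1
  ext d
  simp [Nat.dvd_gcd_iff, hq, and_comm]

lemma mul_pairing_newProjection {q : ℕ} [NeZero q]
    (hcube : ∀ p : ℕ, p.Prime → p ∣ q → p ^ 3 ∣ q) {B : (ℓ : ℕ) → Finset (CuspSpace k ℓ)}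
    (hB : ∀ ℓ : ℕ, ℓ ∣ q → IsOrthonormalBasis V Set.univ (B ℓ)) {m n : ℕ}
    {Rm Rn : CuspSpace k q} (hRm : ∀ φ, inner V φ Rm = conj (rho m φ))
    (hRn : ∀ φ, inner V φ Rn = conj (rho n φ)) :
    V * pairing k (toBoundedForms Rm) (newProjection k q (toBoundedForms Rn)) =
      ∑ d ∈ ((m.gcd n).gcd q).divisors, ∑ e ∈ q.divisors,
        (moebius d * moebius e) • coeffSum (B (q / (d * e))) (m / d) (n / d) := by
  have hterm : ∀ d ∈ q.divisors, ∀ e ∈ q.divisors, Squarefree d → Squarefree e →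
      V * pairing k (toBoundedForms Rm) (upperMean k d (lowerMean k q e (toBoundedForms Rn))) =
        if d ∣ m ∧ d ∣ n then coeffSum (B (q / (d * e))) (m / d) (n / d) else 0 := by
    intro d hd e he hd' he'
    obtain ⟨M, rfl, hdM, heM⟩ := exists_eq_mul_of_squarefree (NeZero.ne q) hcube hd' he'
      (Nat.dvd_of_mem_divisors hd) (Nat.dvd_of_mem_divisors he)
    have : NeZero M := ⟨right_ne_zero_of_mul (NeZero.ne (d * e * M))⟩
    have : NeZero d := ⟨hd'.ne_zero⟩
    have : NeZero e := ⟨he'.ne_zero⟩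
    rw [Nat.mul_div_cancel_left M (Nat.pos_of_neZero (d * e))]
    exact mul_pairing_upperMean_lowerMean hdM heM (hB M (dvd_mul_left M _)) hRm hRn
  rw [pairing_newProjection, sum_divisors_gcd (NeZero.ne q)]
  simp only [Finset.mul_sum, mul_smul_comm]
  rw [sum_moebius_mul_smul_congr hterm]
  exact Finset.sum_congr rfl fun d _ => by split_ifs <;> simp

end MainFormula

end NewformAverage

end

open NewformAverage in
/-- `Bstar` is any orthonormal basis of the newspace `𝒜*(q)` and `B ℓ`, for `ℓ ∣ q`, any orthonormal
basis of `𝒜(ℓ)`, with respect to hyperbolic measures of a common total volume `V`. In the terms with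
`μ d * μ e ≠ 0` one has `d * e ∣ q`, so that all the divisions are exact. -/
theorem mainTheorem5 (k : ℕ) (hk : 0 < k) (q : ℕ) (hq : 0 < q)
    (hcube : ∀ p : ℕ, p.Prime → p ∣ q → p ^ 3 ∣ q)
    (V : ℝ) (hV : 0 < V)
    (Bstar : Finset (NewformAverage.CuspSpace k q))
    (hBstar : NewformAverage.IsOrthonormalBasis V (NewformAverage.newspace V k q) Bstar)
    (B : (ℓ : ℕ) → Finset (NewformAverage.CuspSpace k ℓ))
    (hB : ∀ ℓ : ℕ, ℓ ∣ q → NewformAverage.IsOrthonormalBasis V Set.univ (B ℓ))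
    (m n : ℕ) (hm : 0 < m) (hn : 0 < n) :
    NewformAverage.coeffSum Bstar m n =
      ∑ d ∈ ((m.gcd n).gcd q).divisors, ∑ e ∈ q.divisors,
        ((ArithmeticFunction.moebius d * ArithmeticFunction.moebius e : ℤ) : ℂ) *
          NewformAverage.coeffSum (B (q / (d * e))) (m / d) (n / d) := by
  have : NeZero q := ⟨hq.ne'⟩
  obtain ⟨Rm, hRm⟩ := (hB q dvd_rfl).exists_inner_eq_conj_rho m
  obtain ⟨Rn, hRn⟩ := (hB q dvd_rfl).exists_inner_eq_conj_rho n
  obtain ⟨P, hP_new, hP_old, hP⟩ := exists_mem_newspace_sub_mem_oldspace V hcube Rn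
  have hP_inner (φ : CuspSpace k q) (hφ : φ ∈ newspace V k q) : inner V φ P = conj (rho n φ) := by
    rw [inner_eq_of_sub_mem_oldspace hφ hP_old, hRn]
  simp only [← zsmul_eq_mul]
  calc
    coeffSum Bstar m n = rho m P := hBstar.coeffSum_eq_rho hP_new hP_inner m
    _ = inner V Rm P := by rw [← conj_inner, hRm, Complex.conj_conj]
    _ = V * pairing k (toBoundedForms Rm) (newProjection k q (toBoundedForms Rn)) := by
      rw [inner_eq_pairing, hP]
    _ = _ := mul_pairing_newProjection hcube hB hRm hRn
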